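/- Let $A$ be either the polynomial ring $\mathbb{R}[x_0,x_1,x_2,x_3]$ or the ring of formal power series $\mathbb{R}[[x_0,x_1,x_2,x_3]]$. Write $\partial_i=\partial/\partial x_i$ and $\partial_{i_1\cdots i_k}=\partial_{i_1}\wedge\cdots\wedge\partial_{i_k}$, let $\mathfrak{X}^k$ be the module of $k$-vector fields $\sum_{i_1<\cdots<i_k}f_{i_1\cdots i_k}\partial_{i_1\cdots i_k}$ with coefficients $f_{i_1\cdots i_k}\in A$, and let $[\cdot,\cdot]$ be the Schouten–Nijenhuis bracket. Consider the bivector field $$\pi_\Gamma=x_1\,\partial_2\wedge\partial_3+x_2\,\partial_1\wedge\partial_3-x_3\,\partial_1\wedge\partial_2 ,$$ the linear model of the Poisson structure of a broken Lefschetz fibration around a circle of indefinite fold singularities ($x_0=\theta$ is the coordinate along the circle and $x_1,x_2,x_3$ are the normal coordinates), and let $Q^1=x_0$, $Q^2=-x_1^2+x_2^2+x_3^2$. Then $[\pi_\Gamma,\pi_\Gamma]=0$ and $(\mathfrak{X}^\bullet,\mathrm{d}=[\pi_\Gamma,\cdot])$ is a cochain complex. Let $H^k=\ker(\mathrm{d}\colon\mathfrak{X}^k\to\mathfrak{X}^{k+1})/\mathrm{d}(\mathfrak{X}^{k-1})$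 (with $\mathfrak{X}^{-1}=0$) be its cohomology, a module over the algebra $C=\{f\in A:[\pi_\Gamma,f]=0\}$ of Casimirs. 1. If $A=\mathbb{R}[x_0,x_1,x_2,x_3]$, then $Q^1,Q^2$ are algebraically independent over $\mathbb{R}$ and $C=\mathbb{R}[Q^1,Q^2]$. If $A=\mathbb{R}[[x_0,x_1,x_2,x_3]]$, then substitution of $Q^1,Q^2$ is an injective map $\mathbb{R}[[u_1,u_2]]\to A$ with image $C$, that is, $C=\mathbb{R}[[Q^1,Q^2]]$. 2. In both cases the cohomology is given by the free $C$-modules $$H^0=C\cdot[1],\quad H^1=C\cdot[\partial_0],\quad H^2=0,\quad H^3=C\cdot[\partial_{123}],\quad H^4=C\cdot[\partial_{0123}],$$ where each of the modules $H^0,H^1,H^3,H^4$ is free of rank one with the displayed class as a basis. -/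

import Mathlib

open scoped TensorProduct

noncomputable section

namespace FoldCircle

variable {A : Type*} [CommRing A] [Algebra ℝ A]

/-- Multivector fields in four coordinates `x₀, x₁, x₂, x₃` with coefficients in `A`:
finite sums of terms `f ⊗ ξ`, where `f : A` is the coefficient of the constant multivector `ξ`.
The product of the algebra is the wedge product. -/
abbrev Multivector (A : Type*) [CommRing A] [Algebra ℝ A] : Type _ :=
  A ⊗[ℝ] ExteriorAlgebra ℝ (Fin 4 → ℝ)

/-- The function `f`, as a multivector field of degree `0`. -/
def fn (f : A) : Multivector A := f ⊗ₜ[ℝ] 1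

/-- The coordinate vector field `∂ᵢ`. -/
def vf (A : Type*) [CommRing A] [Algebra ℝ A] (i : Fin 4) : Multivector A :=
  1 ⊗ₜ[ℝ] ExteriorAlgebra.ι ℝ (Pi.single i 1)

/-- The `A`-module `𝔛ᵏ` of `k`-vector fields with coefficients in `A`. -/
def degree (A : Type*) [CommRing A] [Algebra ℝ A] (k : ℕ) : Submodule A (Multivector A) :=
  (⋀[ℝ]^k (Fin 4 → ℝ)).baseChange A

/-- A derivation of `A`, applied to the coefficients of a multivector field. -/
def coeffDeriv (D : Derivation ℝ A A) : Multivector A →ₗ[ℝ] Multivector A :=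
  (D : A →ₗ[ℝ] A).rTensor (ExteriorAlgebra ℝ (Fin 4 → ℝ))

/-- The left contraction with `dxᵢ`, that is, the left derivative with respect to the
anticommuting variable `∂ᵢ`. -/
def contrL (i : Fin 4) : Multivector A →ₗ[ℝ] Multivector A :=
  (CliffordAlgebra.contractLeft (Q := (0 : QuadraticForm ℝ (Fin 4 → ℝ)))
    (LinearMap.proj i : Module.Dual ℝ (Fin 4 → ℝ))).lTensor A

/-- The right contraction with `dxᵢ`, that is, the right derivative with respect to the
anticommuting variable `∂ᵢ`. -/
def contrR (i : Fin 4) : Multivector A →ₗ[ℝ] Multivector A :=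
  ((CliffordAlgebra.contractRight (Q := (0 : QuadraticForm ℝ (Fin 4 → ℝ)))).flip
    (LinearMap.proj i : Module.Dual ℝ (Fin 4 → ℝ))).lTensor A

/-- The Schouten–Nijenhuis bracket of multivector fields, for the partial derivatives
`∂ 0, …, ∂ 3` of `A`. It extends the Lie bracket of vector fields and the action `[X, f] = X(f)`
of vector fields on functions, and satisfies
`[P, Q ∧ R] = [P, Q] ∧ R + (-1) ^ ((p - 1) * q) Q ∧ [P, R]`. -/
def schouten (D : Fin 4 → Derivation ℝ A A) (P Q : Multivector A) : Multivector A :=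
  ∑ i, (contrR i P * coeffDeriv (D i) Q - coeffDeriv (D i) P * contrL i Q)

section Complex

variable (D : Fin 4 → Derivation ℝ A A) (π : Multivector A)

lemma contrL_fn (i : Fin 4) (f : A) : contrL i (fn f) = 0 := by
  simp [contrL, fn, CliffordAlgebra.contractLeft_one]

lemma contrL_smul (i : Fin 4) (f : A) (P : Multivector A) :
    contrL i (f • P) = f • contrL i P := by
  induction P using TensorProduct.induction_on with
  | zero => simp
  | tmul a b => simp [contrL, TensorProduct.smul_tmul']
  | add P Q hP hQ => simp only [smul_add, map_add, hP, hQ]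

lemma coeffDeriv_smul (E : Derivation ℝ A A) (f : A) (P : Multivector A) :
    coeffDeriv E (f • P) = f • coeffDeriv E P + E f • P := by
  induction P using TensorProduct.induction_on with
  | zero => simp
  | tmul a b =>
    simp [coeffDeriv, TensorProduct.smul_tmul', TensorProduct.add_tmul, mul_comm]
  | add P Q hP hQ => simp only [smul_add, map_add, hP, hQ]; abel

lemma fn_mul (f : A) (P : Multivector A) : fn f * P = f • P := by
  induction P using TensorProduct.induction_on with
  | zero => simp
  | tmul a b => simp [fn, TensorProduct.smul_tmul']
  | add P Q hP hQ => simp only [smul_add, mul_add, hP, hQ]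

lemma schouten_add (P Q : Multivector A) :
    schouten D π (P + Q) = schouten D π P + schouten D π Q := by
  simp only [schouten, map_add, mul_add, ← Finset.sum_add_distrib]
  exact Finset.sum_congr rfl fun i _ => by abel

lemma schouten_fn (f : A) :
    schouten D π (fn f) = ∑ i, (D i f) • contrR i π := by
  simp only [schouten, contrL_fn, mul_zero, sub_zero]
  refine Finset.sum_congr rfl fun i _ => ?_
  have h : coeffDeriv (D i) (fn f) = (D i f) • (1 : Multivector A) := by
    simp [coeffDeriv, fn, Algebra.TensorProduct.one_def, TensorProduct.smul_tmul']
  rw [h, mul_smul_comm, mul_one]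

lemma schouten_smul (f : A) (P : Multivector A) :
    schouten D π (f • P) = f • schouten D π P + schouten D π (fn f) * P := by
  rw [schouten_fn]
  simp only [schouten, contrL_smul, coeffDeriv_smul, mul_add, mul_smul_comm, smul_mul_assoc,
    Finset.sum_mul, Finset.smul_sum, smul_sub, ← Finset.sum_add_distrib]
  exact Finset.sum_congr rfl fun i _ => by abel

/-- The algebra of Casimirs of `π`: the functions `f` with `[π, f] = 0`. -/
def casimir : Subalgebra ℝ A where
  carrier := {f | schouten D π (fn f) = 0}
  mul_mem' := by
    intro f g hf hg
    have h : fn (f * g) = f • fn g := by simp [fn, TensorProduct.smul_tmul']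
    simp only [Set.mem_ofPred_eq] at hf hg ⊢
    rw [h, schouten_smul, hf, hg, smul_zero, zero_mul, add_zero]
  add_mem' := by
    intro f g hf hg
    have h : fn (f + g) = fn f + fn g := by simp [fn, TensorProduct.add_tmul]
    simp only [Set.mem_ofPred_eq] at hf hg ⊢
    rw [h, schouten_add, hf, hg, add_zero]
  algebraMap_mem' := by
    intro r
    simp [schouten_fn]

/-- The Poisson coboundary operator `d = [π, ·]`, which is linear over the Casimirs. -/
def dPoisson : Multivector A →ₗ[casimir D π] Multivector A where
  toFun P := schouten D π P
  map_add' := schouten_add D π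
  map_smul' c P := by
    have hc : schouten D π (fn (c : A)) = 0 := c.2
    have h : c • P = (c : A) • P := rfl
    rw [h, schouten_smul, hc, zero_mul, add_zero]
    rfl

/-- The Poisson cocycles of degree `k`. -/
def cocycles (k : ℕ) : Submodule (casimir D π) (Multivector A) :=
  (degree A k).restrictScalars (casimir D π) ⊓ LinearMap.ker (dPoisson D π)

/-- The Poisson coboundaries of degree `k`. -/
def coboundaries : ℕ → Submodule (casimir D π) (Multivector A)
  | 0 => ⊥
  | k + 1 => ((degree A k).restrictScalars (casimir D π)).map (dPoisson D π)

/-- The Poisson cohomology `Hᵏ`, cocycles modulo coboundaries, a module over the Casimirs. -/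
abbrev Cohomology (k : ℕ) : Type _ :=
  cocycles D π k ⧸ (coboundaries D π k).submoduleOf (cocycles D π k)

/-- `Hᵏ` is the free module of rank one over the Casimirs generated by the class of the
cocycle `P`. -/
def IsFreeOnClass (k : ℕ) (P : Multivector A) : Prop :=
  ∃ (hP : P ∈ cocycles D π k) (b : Module.Basis Unit (casimir D π) (Cohomology D π k)),
    b () = Submodule.Quotient.mk ⟨P, hP⟩

end Complex

/-- The bivector field `π_Γ = x₁ ∂₂ ∧ ∂₃ + x₂ ∂₁ ∧ ∂₃ - x₃ ∂₁ ∧ ∂₂`, for coordinates `x`. -/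
def piGamma (x : Fin 4 → A) : Multivector A :=
  x 1 • (vf A 2 * vf A 3) + x 2 • (vf A 1 * vf A 3) - x 3 • (vf A 1 * vf A 2)

/-- The functions `Q¹ = x₀` and `Q² = -x₁² + x₂² + x₃²`, for coordinates `x`. -/
def Q (x : Fin 4 → A) : Fin 2 → A :=
  ![x 0, -(x 1) ^ 2 + (x 2) ^ 2 + (x 3) ^ 2]

/-- What is asserted of the Poisson complex of `π_Γ` for coefficients in `A`, apart from the
description of the Casimirs: `π_Γ` is Poisson, `(𝔛, d)` is a complex, and its cohomology over
the algebra of Casimirs is free on `1`, `∂₀`, nothing, `∂₁₂₃`, `∂₀₁₂₃` in degrees `0, …, 4`. -/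
structure HasFoldCohomology (D : Fin 4 → Derivation ℝ A A) (x : Fin 4 → A) : Prop where
  poisson : schouten D (piGamma x) (piGamma x) = 0
  isComplex : ∀ k, coboundaries D (piGamma x) k ≤ cocycles D (piGamma x) k
  H0 : IsFreeOnClass D (piGamma x) 0 1
  H1 : IsFreeOnClass D (piGamma x) 1 (vf A 0)
  H2 : Subsingleton (Cohomology D (piGamma x) 2)
  H3 : IsFreeOnClass D (piGamma x) 3 (vf A 1 * vf A 2 * vf A 3)
  H4 : IsFreeOnClass D (piGamma x) 4 (vf A 0 * vf A 1 * vf A 2 * vf A 3)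

/-- Polynomials in four variables, their coordinates and partial derivatives. -/
abbrev Poly : Type := MvPolynomial (Fin 4) ℝ

def polyX : Fin 4 → Poly := MvPolynomial.X

def polyD : Fin 4 → Derivation ℝ Poly Poly := fun i => MvPolynomial.pderiv i

/-- Formal power series in four variables, their coordinates and partial derivatives. -/
abbrev Ser : Type := MvPowerSeries (Fin 4) ℝ

def serX : Fin 4 → Ser := MvPowerSeries.X

def serD : Fin 4 → Derivation ℝ Ser Ser := fun i => MvPowerSeries.pderiv ℝ i

end FoldCircle

end

/-! Since `π_Γ` involves neither `x₀` nor `∂₀`, the complex is `B ⊕ ∂₀ ∧ B`, where `B` is generated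
by `∂₁, ∂₂, ∂₃` over `A`, and `d` anticommutes with `∂₀ ∧ ·` (`schouten_vf_zero_mul`). On `B`, `d`
is the Chevalley–Eilenberg differential of `so(2,1)` acting on `A` through `ham₁`, `ham₂`, `ham₃`.
The claim thus becomes a Whitehead theorem: `B` has cohomology `C` in degrees 0 and 3, and none in
degrees 1 and 2.

As `A` is infinite-dimensional, complete reducibility is replaced by an explicit
`IsCasimirSplitting`: equivariant operators `P`, onto the invariants, and `G`, with `f = P f + Ω (G
f)` for the Casimir operator `Ω`. Primitives are then written down from `P` and `G` (`exists_vec`,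
`exists_bivec`, `exists_trivec`).

The splitting comes from `E² + E = Ω + Q² Δ` (`euler_euler_add_euler`). Inverting `E² + E` off
degree 0 by `N` gives `f = f₀ + Ω N f + Q² · lower f`, with `f₀` the component of degree 0 in `x₁,
x₂, x₃`. Iteration yields `P f = ∑ (Q²)ᵏ (lowerᵏ f)₀` and `G f = ∑ (Q²)ᵏ N (lowerᵏ f)`. These sums
make sense because `lower` is locally nilpotent on polynomials, and because `Q²` has positive order
for power series. All properties of `P` and `G` follow from the recursions they solve, as only `0`
is divisible by every power of `Q²` (`exists_splitting`). Each `(lowerᵏ f)₀` depends on `x₀` alone,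
so the formula for `P` also exhibits Casimirs as polynomials or series in `Q¹, Q²`. -/

namespace FoldCircle

/-! ### Wedge products, contractions and grading of multivector fields. -/

section Multivectors

variable {A : Type*} [CommRing A] [Algebra ℝ A]

lemma vf_mul_self (i : Fin 4) : vf A i * vf A i = 0 := by
  simp [vf, Algebra.TensorProduct.tmul_mul_tmul]

lemma vf_mul_self_mul (i : Fin 4) (P : Multivector A) : vf A i * (vf A i * P) = 0 := by
  rw [← mul_assoc, vf_mul_self, zero_mul]

lemma vf_mul_comm (i j : Fin 4) : vf A i * vf A j = -(vf A j * vf A i) := by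
  rw [eq_neg_iff_add_eq_zero]
  simp [vf, Algebra.TensorProduct.tmul_mul_tmul, ← TensorProduct.tmul_add,
    ExteriorAlgebra.ι_add_mul_swap]

lemma vf_mul_left_comm (i j : Fin 4) (P : Multivector A) :
    vf A i * (vf A j * P) = -(vf A j * (vf A i * P)) := by
  rw [← mul_assoc, vf_mul_comm, neg_mul, mul_assoc]

lemma contrL_one (i : Fin 4) : contrL i (1 : Multivector A) = 0 := contrL_fn i 1

lemma contrL_vf_mul (i j : Fin 4) (P : Multivector A) :
    contrL i (vf A j * P) = (if i = j then P else 0) - vf A j * contrL i P := by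
  induction P using TensorProduct.induction_on with
  | zero => simp
  | tmul a b =>
    have h := CliffordAlgebra.contractLeft_ι_mul (Q := (0 : QuadraticForm ℝ (Fin 4 → ℝ)))
      (d := LinearMap.proj i) (Pi.single j 1) b
    simp only [contrL, vf, Algebra.TensorProduct.tmul_mul_tmul, one_mul, LinearMap.lTensor_tmul]
    -- The exterior algebra is the Clifford algebra of the zero form, but its `ι` matches the
    -- Clifford one only after unfolding.
    erw [h]
    rw [TensorProduct.tmul_sub]
    congr 1
    by_cases hij : i = j <;> simp [hij]
  | add P Q hP hQ =>
    simp only [mul_add, map_add, hP, hQ]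
    split_ifs <;> abel

lemma contrL_vf (i j : Fin 4) :
    contrL i (vf A j) = if i = j then 1 else 0 := by
  simpa [contrL_one] using contrL_vf_mul (A := A) i j 1

lemma contrR_one (i : Fin 4) : contrR i (1 : Multivector A) = 0 := by
  simp [contrR, Algebra.TensorProduct.one_def, CliffordAlgebra.contractRight_one]

lemma contrR_smul (i : Fin 4) (f : A) (P : Multivector A) :
    contrR i (f • P) = f • contrR i P := by
  induction P using TensorProduct.induction_on with
  | zero => simp
  | tmul a b => simp [contrR, TensorProduct.smul_tmul']
  | add P Q hP hQ => simp only [smul_add, map_add, hP, hQ]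

lemma contrR_mul_vf (i j : Fin 4) (P : Multivector A) :
    contrR i (P * vf A j) = (if i = j then P else 0) - contrR i P * vf A j := by
  induction P using TensorProduct.induction_on with
  | zero => simp
  | tmul a b =>
    have h := CliffordAlgebra.contractRight_mul_ι (Q := (0 : QuadraticForm ℝ (Fin 4 → ℝ)))
      (d := LinearMap.proj i) (Pi.single j 1) b
    simp only [contrR, vf, Algebra.TensorProduct.tmul_mul_tmul, mul_one, LinearMap.lTensor_tmul,
      LinearMap.flip_apply]
    erw [h]
    rw [TensorProduct.tmul_sub]
    congr 1
    by_cases hij : i = j <;> simp [hij]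
  | add P Q hP hQ =>
    simp only [add_mul, map_add, hP, hQ]
    split_ifs <;> abel

lemma contrR_vf (i j : Fin 4) :
    contrR i (vf A j) = if i = j then 1 else 0 := by
  simpa [contrR_one] using contrR_mul_vf (A := A) i j 1

lemma coeffDeriv_one (E : Derivation ℝ A A) : coeffDeriv E (1 : Multivector A) = 0 := by
  simp [coeffDeriv, Algebra.TensorProduct.one_def]

lemma coeffDeriv_vf_mul (E : Derivation ℝ A A) (j : Fin 4) (P : Multivector A) :
    coeffDeriv E (vf A j * P) = vf A j * coeffDeriv E P := by
  induction P using TensorProduct.induction_on with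
  | zero => simp
  | tmul a b => simp [coeffDeriv, vf, Algebra.TensorProduct.tmul_mul_tmul]
  | add P Q hP hQ => simp only [mul_add, map_add, hP, hQ]

lemma coeffDeriv_vf (E : Derivation ℝ A A) (j : Fin 4) : coeffDeriv E (vf A j) = 0 := by
  simpa [coeffDeriv_one] using coeffDeriv_vf_mul E j 1

/-- The component of degree `0` of a multivector field. -/
noncomputable def aug (A : Type*) [CommRing A] [Algebra ℝ A] : Multivector A →ₗ[ℝ] A :=
  (TensorProduct.rid ℝ A).toLinearMap ∘ₗ
    (ExteriorAlgebra.algebraMapInv (R := ℝ) (M := Fin 4 → ℝ)).toLinearMap.lTensor A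

lemma aug_one : aug A 1 = 1 := by
  simp [aug, Algebra.TensorProduct.one_def]

lemma aug_smul (f : A) (P : Multivector A) : aug A (f • P) = f * aug A P := by
  induction P using TensorProduct.induction_on with
  | zero => simp
  | tmul a b => simp [aug, TensorProduct.smul_tmul']
  | add P Q hP hQ => simp only [smul_add, mul_add, map_add, hP, hQ]

lemma aug_vf_mul (j : Fin 4) (P : Multivector A) : aug A (vf A j * P) = 0 := by
  induction P using TensorProduct.induction_on with
  | zero => simp
  | tmul a b =>
    simp [aug, vf, Algebra.TensorProduct.tmul_mul_tmul, ExteriorAlgebra.algebraMapInv]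
  | add P Q hP hQ => simp only [mul_add, map_add, hP, hQ, add_zero]

lemma one_mem_degree : (1 : Multivector A) ∈ degree A 0 :=
  Submodule.tmul_mem_baseChange_of_mem (A := A) (1 : A) (by simp)

lemma vf_mul_mem_degree (i : Fin 4) {k : ℕ} {P : Multivector A} (hP : P ∈ degree A k) :
    vf A i * P ∈ degree A (k + 1) := by
  rw [degree, Submodule.baseChange_eq_span] at hP
  induction hP using Submodule.span_induction with
  | mem P h =>
    obtain ⟨ξ, hξ, rfl⟩ := h
    simp only [vf, TensorProduct.mk_apply, Algebra.TensorProduct.tmul_mul_tmul, one_mul]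
    refine Submodule.tmul_mem_baseChange_of_mem (A := A) (1 : A) ?_
    rw [ExteriorAlgebra.exteriorPower, pow_succ']
    exact Submodule.mul_mem_mul ⟨_, rfl⟩ hξ
  | zero => simp
  | add P Q _ _ hP hQ => rw [mul_add]; exact add_mem hP hQ
  | smul f P _ hP => rw [mul_smul_comm]; exact Submodule.smul_mem _ f hP

lemma vf_mem_degree (i : Fin 4) : vf A i ∈ degree A 1 := by
  simpa using vf_mul_mem_degree i (one_mem_degree (A := A))

lemma degree_zero_le {M : Submodule A (Multivector A)} (h : 1 ∈ M) : degree A 0 ≤ M := by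
  rw [degree, Submodule.baseChange_eq_span, Submodule.span_le]
  rintro _ ⟨ξ, hξ, rfl⟩
  rw [SetLike.mem_coe, ExteriorAlgebra.exteriorPower, pow_zero, Submodule.mem_one] at hξ
  obtain ⟨r, rfl⟩ := hξ
  have : (1 : A) ⊗ₜ[ℝ] (algebraMap ℝ (ExteriorAlgebra ℝ (Fin 4 → ℝ)) r)
      = algebraMap ℝ A r • (1 : Multivector A) := by
    rw [Algebra.algebraMap_eq_smul_one, TensorProduct.tmul_smul, algebraMap_smul]; rfl
  rw [SetLike.mem_coe, TensorProduct.mk_apply, this]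
  exact M.smul_mem _ h

/-- Each degree is generated by wedging coordinate fields onto the preceding one. With
`degree_zero_le`, this is the induction that produces the normal forms in coordinates. -/
lemma degree_succ_le {k : ℕ} {M : Submodule A (Multivector A)}
    (h : ∀ i, ∀ P ∈ degree A k, vf A i * P ∈ M) : degree A (k + 1) ≤ M := by
  rw [degree, Submodule.baseChange_eq_span, Submodule.span_le]
  rintro _ ⟨ξ, hξ, rfl⟩
  rw [SetLike.mem_coe, ExteriorAlgebra.exteriorPower, pow_succ'] at hξ
  induction hξ using Submodule.mul_induction_on' with
  | mem_mul_mem a ha b hb =>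
    obtain ⟨u, rfl⟩ := ha
    have hu : (1 : A) ⊗ₜ[ℝ] (ExteriorAlgebra.ι ℝ u * b)
        = ∑ i, algebraMap ℝ A (u i) • (vf A i * (1 : A) ⊗ₜ[ℝ] b) := by
      conv_lhs => rw [← Finset.univ_sum_single u]
      simp only [map_sum, Finset.sum_mul, TensorProduct.tmul_sum]
      refine Finset.sum_congr rfl fun i _ => ?_
      have : (Pi.single i (u i) : Fin 4 → ℝ) = u i • Pi.single i 1 := by
        rw [← Pi.single_smul, smul_eq_mul, mul_one]
      rw [this, map_smul, smul_mul_assoc, TensorProduct.tmul_smul, algebraMap_smul, vf,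
        Algebra.TensorProduct.tmul_mul_tmul, one_mul]
    rw [SetLike.mem_coe, TensorProduct.mk_apply, hu]
    exact sum_mem fun i _ => M.smul_mem _
      (h i _ (Submodule.tmul_mem_baseChange_of_mem (A := A) (1 : A) hb))
  | add a _ b _ ha hb => simpa [TensorProduct.tmul_add] using add_mem ha hb

end Multivectors

/-! ### Normal forms of multivector fields in each degree. -/

section Coordinates

variable {A : Type*} [CommRing A] [Algebra ℝ A]

/-- The vector field `F₁ ∂₁ + F₂ ∂₂ + F₃ ∂₃`. -/
noncomputable def vec (F₁ F₂ F₃ : A) : Multivector A :=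
  F₁ • vf A 1 + F₂ • vf A 2 + F₃ • vf A 3

/-- The bivector field `G₁ ∂₂₃ + G₂ ∂₃₁ + G₃ ∂₁₂`. -/
noncomputable def bivec (G₁ G₂ G₃ : A) : Multivector A :=
  G₁ • (vf A 2 * vf A 3) + G₂ • (vf A 3 * vf A 1) + G₃ • (vf A 1 * vf A 2)

/-- The trivector field `f ∂₁₂₃`. -/
noncomputable def trivec (f : A) : Multivector A := f • (vf A 1 * (vf A 2 * vf A 3))

lemma vec_mem_degree (F₁ F₂ F₃ : A) : vec F₁ F₂ F₃ ∈ degree A 1 :=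
  add_mem (add_mem (Submodule.smul_mem _ _ (vf_mem_degree 1))
    (Submodule.smul_mem _ _ (vf_mem_degree 2))) (Submodule.smul_mem _ _ (vf_mem_degree 3))

lemma bivec_mem_degree (G₁ G₂ G₃ : A) : bivec G₁ G₂ G₃ ∈ degree A 2 :=
  have h (i j : Fin 4) : vf A i * vf A j ∈ degree A 2 := vf_mul_mem_degree i (vf_mem_degree j)
  add_mem (add_mem (Submodule.smul_mem _ _ (h _ _)) (Submodule.smul_mem _ _ (h _ _)))
    (Submodule.smul_mem _ _ (h _ _))

lemma trivec_mem_degree (f : A) : trivec f ∈ degree A 3 :=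
  Submodule.smul_mem _ _ (vf_mul_mem_degree _ (vf_mul_mem_degree _ (vf_mem_degree _)))

lemma smul_one_mem_degree (f : A) : f • (1 : Multivector A) ∈ degree A 0 :=
  Submodule.smul_mem _ _ one_mem_degree

/-- These rules and their primed versions sort wedge products by increasing index. Orienting each
pair separately lets `simp` terminate, which the general anticommutation rule would not. -/
lemma vf_normal₁₀ : vf A 1 * vf A 0 = -(vf A 0 * vf A 1) := vf_mul_comm 1 0
lemma vf_normal₂₀ : vf A 2 * vf A 0 = -(vf A 0 * vf A 2) := vf_mul_comm 2 0
lemma vf_normal₃₀ : vf A 3 * vf A 0 = -(vf A 0 * vf A 3) := vf_mul_comm 3 0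
lemma vf_normal₂₁ : vf A 2 * vf A 1 = -(vf A 1 * vf A 2) := vf_mul_comm 2 1
lemma vf_normal₃₁ : vf A 3 * vf A 1 = -(vf A 1 * vf A 3) := vf_mul_comm 3 1
lemma vf_normal₃₂ : vf A 3 * vf A 2 = -(vf A 2 * vf A 3) := vf_mul_comm 3 2
lemma vf_normal₁₀' (P : Multivector A) : vf A 1 * (vf A 0 * P) = -(vf A 0 * (vf A 1 * P)) :=
  vf_mul_left_comm 1 0 P
lemma vf_normal₂₀' (P : Multivector A) : vf A 2 * (vf A 0 * P) = -(vf A 0 * (vf A 2 * P)) :=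
  vf_mul_left_comm 2 0 P
lemma vf_normal₃₀' (P : Multivector A) : vf A 3 * (vf A 0 * P) = -(vf A 0 * (vf A 3 * P)) :=
  vf_mul_left_comm 3 0 P
lemma vf_normal₂₁' (P : Multivector A) : vf A 2 * (vf A 1 * P) = -(vf A 1 * (vf A 2 * P)) :=
  vf_mul_left_comm 2 1 P
lemma vf_normal₃₁' (P : Multivector A) : vf A 3 * (vf A 1 * P) = -(vf A 1 * (vf A 3 * P)) :=
  vf_mul_left_comm 3 1 P
lemma vf_normal₃₂' (P : Multivector A) : vf A 3 * (vf A 2 * P) = -(vf A 2 * (vf A 3 * P)) :=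
  vf_mul_left_comm 3 2 P

lemma exists_of_mem_degree_zero {P : Multivector A} (hP : P ∈ degree A 0) :
    ∃ f : A, P = f • 1 := by
  have h := degree_zero_le (M := Submodule.span A {(1 : Multivector A)})
    (Submodule.subset_span rfl) hP
  obtain ⟨f, rfl⟩ := Submodule.mem_span_singleton.1 h
  exact ⟨f, rfl⟩

/-- Here and in the higher degrees `∂₀` is factored out on the left, which splits the complex into
two copies of the one in the normal directions. -/
lemma exists_of_mem_degree_one {P : Multivector A} (hP : P ∈ degree A 1) :
    ∃ f F₁ F₂ F₃ : A, P = vf A 0 * f • 1 + vec F₁ F₂ F₃ := by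
  let M : Submodule A (Multivector A) :=
    { carrier := {P | ∃ f F₁ F₂ F₃ : A, P = vf A 0 * f • 1 + vec F₁ F₂ F₃}
      zero_mem' := ⟨0, 0, 0, 0, by simp [vec]⟩
      add_mem' := by
        rintro _ _ ⟨f, F₁, F₂, F₃, rfl⟩ ⟨g, G₁, G₂, G₃, rfl⟩
        refine ⟨f + g, F₁ + G₁, F₂ + G₂, F₃ + G₃, ?_⟩
        simp only [vec, mul_smul_comm, mul_one]
        module
      smul_mem' := by
        rintro a _ ⟨f, F₁, F₂, F₃, rfl⟩
        refine ⟨a * f, a * F₁, a * F₂, a * F₃, ?_⟩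
        simp only [vec, mul_smul_comm, mul_one]
        module }
  refine degree_succ_le (M := M) (fun i P hP => ?_) hP
  obtain ⟨f, rfl⟩ := exists_of_mem_degree_zero hP
  rw [mul_smul_comm, mul_one]
  refine M.smul_mem f ?_
  fin_cases i
  · exact ⟨1, 0, 0, 0, by simp [vec]⟩
  · exact ⟨0, 1, 0, 0, by simp [vec]⟩
  · exact ⟨0, 0, 1, 0, by simp [vec]⟩
  · exact ⟨0, 0, 0, 1, by simp [vec]⟩

lemma exists_of_mem_degree_two {P : Multivector A} (hP : P ∈ degree A 2) :
    ∃ F₁ F₂ F₃ G₁ G₂ G₃ : A, P = vf A 0 * vec F₁ F₂ F₃ + bivec G₁ G₂ G₃ := by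
  let M : Submodule A (Multivector A) :=
    { carrier := {P | ∃ F₁ F₂ F₃ G₁ G₂ G₃ : A, P = vf A 0 * vec F₁ F₂ F₃ + bivec G₁ G₂ G₃}
      zero_mem' := ⟨0, 0, 0, 0, 0, 0, by simp [vec, bivec]⟩
      add_mem' := by
        rintro _ _ ⟨f₁, f₂, f₃, F₁, F₂, F₃, rfl⟩ ⟨g₁, g₂, g₃, G₁, G₂, G₃, rfl⟩
        refine ⟨f₁ + g₁, f₂ + g₂, f₃ + g₃, F₁ + G₁, F₂ + G₂, F₃ + G₃, ?_⟩
        simp only [vec, bivec, mul_smul_comm, mul_add]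
        module
      smul_mem' := by
        rintro a _ ⟨f₁, f₂, f₃, F₁, F₂, F₃, rfl⟩
        refine ⟨a * f₁, a * f₂, a * f₃, a * F₁, a * F₂, a * F₃, ?_⟩
        simp only [vec, bivec, mul_smul_comm, mul_add]
        module }
  refine degree_succ_le (M := M) (fun i P hP => ?_) hP
  obtain ⟨f, F₁, F₂, F₃, rfl⟩ := exists_of_mem_degree_one hP
  fin_cases i
  · refine ⟨F₁, F₂, F₃, 0, 0, 0, ?_⟩
    simp [vec, bivec, mul_add, vf_mul_self]
  · refine ⟨-f, 0, 0, 0, -F₃, F₂, ?_⟩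
    simp [vec, bivec, mul_add, vf_mul_self, vf_normal₁₀, vf_normal₃₁]
    module
  · refine ⟨0, -f, 0, F₃, 0, -F₁, ?_⟩
    simp [vec, bivec, mul_add, vf_mul_self, vf_normal₂₀, vf_normal₂₁]
    module
  · refine ⟨0, 0, -f, -F₂, F₁, 0, ?_⟩
    simp [vec, bivec, mul_add, vf_mul_self, vf_normal₃₀, vf_normal₃₂]
    module

lemma exists_of_mem_degree_three {P : Multivector A} (hP : P ∈ degree A 3) :
    ∃ G₁ G₂ G₃ f : A, P = vf A 0 * bivec G₁ G₂ G₃ + trivec f := by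
  let M : Submodule A (Multivector A) :=
    { carrier := {P | ∃ G₁ G₂ G₃ f : A, P = vf A 0 * bivec G₁ G₂ G₃ + trivec f}
      zero_mem' := ⟨0, 0, 0, 0, by simp [trivec, bivec]⟩
      add_mem' := by
        rintro _ _ ⟨F₁, F₂, F₃, f, rfl⟩ ⟨G₁, G₂, G₃, g, rfl⟩
        refine ⟨F₁ + G₁, F₂ + G₂, F₃ + G₃, f + g, ?_⟩
        simp only [bivec, trivec, mul_smul_comm, mul_add]
        module
      smul_mem' := by
        rintro a _ ⟨F₁, F₂, F₃, f, rfl⟩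
        refine ⟨a * F₁, a * F₂, a * F₃, a * f, ?_⟩
        simp only [bivec, trivec, mul_smul_comm, mul_add]
        module }
  refine degree_succ_le (M := M) (fun i P hP => ?_) hP
  obtain ⟨F₁, F₂, F₃, G₁, G₂, G₃, rfl⟩ := exists_of_mem_degree_two hP
  fin_cases i
  · refine ⟨G₁, G₂, G₃, 0, ?_⟩
    simp [vec, trivec, mul_add, vf_mul_self_mul]
  · refine ⟨0, F₃, -F₂, G₁, ?_⟩
    simp [vec, bivec, trivec, mul_add, vf_mul_self_mul, vf_mul_self, vf_normal₁₀', vf_normal₃₁]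
    module
  · refine ⟨-F₃, 0, F₁, G₂, ?_⟩
    simp [vec, bivec, trivec, mul_add, vf_mul_self_mul, vf_mul_self, vf_normal₂₀', vf_normal₂₁,
      vf_normal₂₁', vf_normal₃₁]
    module
  · refine ⟨F₂, -F₁, 0, G₃, ?_⟩
    simp [vec, bivec, trivec, mul_add, vf_mul_self, vf_normal₃₀', vf_normal₃₂,
      vf_normal₃₁', vf_normal₃₁, vf_normal₃₂']
    module

lemma exists_of_mem_degree_four {P : Multivector A} (hP : P ∈ degree A 4) :
    ∃ f : A, P = vf A 0 * trivec f := by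
  let M : Submodule A (Multivector A) :=
    { carrier := {P | ∃ f : A, P = vf A 0 * trivec f}
      zero_mem' := ⟨0, by simp [trivec]⟩
      add_mem' := by
        rintro _ _ ⟨f, rfl⟩ ⟨g, rfl⟩
        exact ⟨f + g, by simp only [trivec, mul_smul_comm]; module⟩
      smul_mem' := by
        rintro a _ ⟨f, rfl⟩
        exact ⟨a * f, by simp only [trivec, mul_smul_comm]; module⟩ }
  refine degree_succ_le (M := M) (fun i P hP => ?_) hP
  obtain ⟨G₁, G₂, G₃, f, rfl⟩ := exists_of_mem_degree_three hP
  fin_cases i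
  · refine ⟨f, ?_⟩
    simp [mul_add, vf_mul_self_mul]
  · refine ⟨-G₁, ?_⟩
    simp [bivec, trivec, mul_add, vf_mul_self_mul, vf_normal₁₀', vf_normal₃₁]
  · refine ⟨-G₂, ?_⟩
    simp [bivec, trivec, mul_add, vf_mul_self_mul, vf_mul_self, vf_normal₂₀',
      vf_normal₂₁', vf_normal₃₁]
  · refine ⟨-G₃, ?_⟩
    simp [bivec, trivec, mul_add, vf_mul_self, vf_normal₃₀', vf_normal₃₂,
      vf_normal₃₁', vf_normal₃₁, vf_normal₃₂']

/-- Needed because the complex property is asserted for every natural number `k`. -/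
lemma degree_eq_bot (k : ℕ) : degree A (k + 5) = ⊥ := by
  induction k with
  | zero =>
    refine eq_bot_iff.2 (degree_succ_le fun i P hP => ?_)
    obtain ⟨f, rfl⟩ := exists_of_mem_degree_four hP
    fin_cases i <;>
    simp [trivec, vf_mul_self_mul, vf_mul_self, vf_normal₁₀', vf_normal₂₀', vf_normal₃₀',
      vf_normal₂₁', vf_normal₃₁', vf_normal₃₂']
  | succ k ih =>
    refine eq_bot_iff.2 (degree_succ_le fun i P hP => ?_)
    rw [ih, Submodule.mem_bot] at hP
    simp [hP]

lemma smul_one_eq_zero {f : A} (h : f • (1 : Multivector A) = 0) : f = 0 := by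
  simpa [aug_smul, aug_one] using congrArg (aug A) h

/-- Contracting with the `dxᵢ` and then applying `aug` reads off single coefficients; the next two
lemmas do the same with iterated contractions. -/
lemma vec_eq_zero {F₁ F₂ F₃ : A} (h : vec F₁ F₂ F₃ = 0) : F₁ = 0 ∧ F₂ = 0 ∧ F₃ = 0 := by
  have key (i : Fin 4) := congrArg (fun P => aug A (contrL i P)) h
  refine ⟨?_, ?_, ?_⟩
  · simpa [vec, contrL_smul, contrL_vf, aug_smul, aug_one] using key 1
  · simpa [vec, contrL_smul, contrL_vf, aug_smul, aug_one] using key 2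
  · simpa [vec, contrL_smul, contrL_vf, aug_smul, aug_one] using key 3

lemma bivec_eq_zero {G₁ G₂ G₃ : A} (h : bivec G₁ G₂ G₃ = 0) : G₁ = 0 ∧ G₂ = 0 ∧ G₃ = 0 := by
  have key (i j : Fin 4) := congrArg (fun P => aug A (contrL j (contrL i P))) h
  refine ⟨?_, ?_, ?_⟩
  · simpa [bivec, contrL_smul, contrL_vf, contrL_vf_mul, contrL_one, aug_smul, aug_one]
      using key 2 3
  · simpa [bivec, contrL_smul, contrL_vf, contrL_vf_mul, contrL_one, aug_smul, aug_one]
      using key 3 1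
  · simpa [bivec, contrL_smul, contrL_vf, contrL_vf_mul, contrL_one, aug_smul, aug_one]
      using key 1 2

lemma trivec_eq_zero {f : A} (h : trivec f = 0) : f = 0 := by
  simpa [trivec, contrL_smul, contrL_vf, contrL_vf_mul, contrL_one, aug_smul, aug_one]
    using congrArg (fun P => aug A (contrL 3 (contrL 2 (contrL 1 P)))) h

/-- Multivector fields without `∂₀`-component are recovered by contraction with `dx₀`. -/
lemma contrL_zero_vf_mul_add {P Q : Multivector A} (hP : contrL 0 P = 0) (hQ : contrL 0 Q = 0) :
    contrL 0 (vf A 0 * P + Q) = P := by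
  simp [contrL_vf_mul, hP, hQ]

lemma vf_zero_mul_add_eq_zero {P Q : Multivector A} (hP : contrL 0 P = 0) (hQ : contrL 0 Q = 0)
    (h : vf A 0 * P + Q = 0) : P = 0 ∧ Q = 0 := by
  have h₁ : P = 0 := by rw [← contrL_zero_vf_mul_add hP hQ, h, map_zero]
  exact ⟨h₁, by simpa [h₁] using h⟩

lemma contrL_zero_smul_one (f : A) : contrL 0 (f • (1 : Multivector A)) = 0 := by
  simp [contrL_smul, contrL_one]

lemma contrL_zero_vec (F₁ F₂ F₃ : A) : contrL 0 (vec F₁ F₂ F₃) = 0 := by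
  simp [vec, contrL_smul, contrL_vf]

lemma contrL_zero_bivec (G₁ G₂ G₃ : A) : contrL 0 (bivec G₁ G₂ G₃) = 0 := by
  simp [bivec, contrL_smul, contrL_vf, contrL_vf_mul]

lemma contrL_zero_trivec (f : A) : contrL 0 (trivec f) = 0 := by
  simp [trivec, contrL_smul, contrL_vf, contrL_vf_mul]

end Coordinates

/-! ### The Poisson differential as the Chevalley–Eilenberg differential of `so(2,1)`. -/

section Differential

variable {A : Type*} [CommRing A] [Algebra ℝ A] (D : Fin 4 → Derivation ℝ A A) (x : Fin 4 → A)

/-- The component along `∂₁` of the Hamiltonian vector field `[π_Γ, ·]`. -/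
noncomputable def ham₁ : A →ₗ[ℝ] A := (x 2 • D 3 - x 3 • D 2 : Derivation ℝ A A)

/-- The component along `∂₂` of the Hamiltonian vector field `[π_Γ, ·]`. -/
noncomputable def ham₂ : A →ₗ[ℝ] A := (x 3 • D 1 + x 1 • D 3 : Derivation ℝ A A)

/-- The component along `∂₃` of the Hamiltonian vector field `[π_Γ, ·]`. -/
noncomputable def ham₃ : A →ₗ[ℝ] A := (-(x 2 • D 1) - x 1 • D 2 : Derivation ℝ A A)

lemma ham₁_apply (f : A) : ham₁ D x f = x 2 * D 3 f - x 3 * D 2 f := rfl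
lemma ham₂_apply (f : A) : ham₂ D x f = x 3 * D 1 f + x 1 * D 3 f := rfl
lemma ham₃_apply (f : A) : ham₃ D x f = -(x 2 * D 1 f) - x 1 * D 2 f := rfl

lemma piGamma_eq_bivec : piGamma x = bivec (x 1) (-x 2) (-x 3) := by
  simp [piGamma, bivec, vf_normal₃₁]
  module

variable {D x} (hx : ∀ i j, D i (x j) = if i = j then 1 else 0)
include hx

/-- The summand `i = 0` vanishes because `π_Γ` contains neither `∂₀` nor `x₀`. The first three terms
differentiate the coefficients of `P`; the last ones, with constant coefficients because `π_Γ` is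
linear, carry the Lie bracket. -/
lemma schouten_piGamma (P : Multivector A) :
    schouten D (piGamma x) P =
      (x 3 • vf A 2 - x 2 • vf A 3) * coeffDeriv (D 1) P
      - (x 1 • vf A 3 + x 3 • vf A 1) * coeffDeriv (D 2) P
      + (x 1 • vf A 2 + x 2 • vf A 1) * coeffDeriv (D 3) P
      - (vf A 2 * vf A 3 * contrL 1 P + vf A 1 * vf A 3 * contrL 2 P
          - vf A 1 * vf A 2 * contrL 3 P) := by
  simp only [schouten, piGamma, Fin.sum_univ_four, map_add, map_sub, contrR_smul, contrR_mul_vf,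
    contrR_vf, coeffDeriv_smul, coeffDeriv_vf_mul, coeffDeriv_vf, hx]
  simp
  noncomm_ring

lemma schouten_smul_one (f : A) :
    schouten D (piGamma x) (f • 1) = vec (ham₁ D x f) (ham₂ D x f) (ham₃ D x f) := by
  simp only [schouten_piGamma hx, vec, ham₁_apply, ham₂_apply, ham₃_apply, contrL_smul, contrL_one,
    coeffDeriv_smul, coeffDeriv_one, smul_zero, zero_add, mul_smul_comm, mul_one, mul_zero]
  module

/-- The terms without `ham` come from the structure constants of the Lie algebra. -/
lemma schouten_vec (F₁ F₂ F₃ : A) :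
    schouten D (piGamma x) (vec F₁ F₂ F₃) =
      bivec (ham₂ D x F₃ - ham₃ D x F₂ - F₁) (ham₃ D x F₁ - ham₁ D x F₃ + F₂)
        (ham₁ D x F₂ - ham₂ D x F₁ + F₃) := by
  simp [schouten_piGamma hx, vec, bivec, ham₁_apply, ham₂_apply, ham₃_apply, contrL_smul, contrL_vf,
    coeffDeriv_smul, coeffDeriv_vf, mul_add, add_mul, sub_mul, vf_mul_self,
    vf_normal₂₁, vf_normal₃₁, vf_normal₃₂]
  module

lemma schouten_bivec (G₁ G₂ G₃ : A) :
    schouten D (piGamma x) (bivec G₁ G₂ G₃) =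
      trivec (ham₁ D x G₁ + ham₂ D x G₂ + ham₃ D x G₃) := by
  simp [schouten_piGamma hx, trivec, bivec, ham₁_apply, ham₂_apply, ham₃_apply, contrL_smul,
    contrL_vf, contrL_vf_mul, coeffDeriv_smul, coeffDeriv_vf, coeffDeriv_vf_mul, mul_add, add_mul,
    sub_mul, mul_assoc, vf_mul_self, vf_mul_self_mul,
    vf_normal₂₁, vf_normal₃₁, vf_normal₃₂, vf_normal₂₁', vf_normal₃₁', vf_normal₃₂']
  module

lemma schouten_trivec (f : A) : schouten D (piGamma x) (trivec f) = 0 := by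
  simp [schouten_piGamma hx, trivec, contrL_smul,
    contrL_vf, contrL_vf_mul, coeffDeriv_smul, coeffDeriv_vf, coeffDeriv_vf_mul, add_mul,
    sub_mul, mul_assoc, vf_mul_self, vf_mul_self_mul,
    vf_normal₂₁', vf_normal₃₁', vf_normal₃₂']

lemma schouten_vf_zero_mul (P : Multivector A) :
    schouten D (piGamma x) (vf A 0 * P) = -(vf A 0 * schouten D (piGamma x) P) := by
  simp [schouten_piGamma hx, contrL_vf_mul, coeffDeriv_vf_mul, mul_add, add_mul,
    sub_mul, mul_sub, mul_assoc, vf_normal₁₀', vf_normal₂₀', vf_normal₃₀']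
  module

lemma schouten_piGamma_self : schouten D (piGamma x) (piGamma x) = 0 := by
  nth_rw 2 [piGamma_eq_bivec]
  rw [schouten_bivec hx]
  simp [ham₁_apply, ham₂_apply, ham₃_apply, hx, trivec]

variable (hD : ∀ i j f, D i (D j f) = D j (D i f))
include hD

/-- This and the next two are the commutation relations of `so(2,1)`, directed so as to serve as
rewriting rules. -/
lemma ham₂_ham₃ (f : A) : ham₂ D x (ham₃ D x f) = ham₃ D x (ham₂ D x f) + ham₁ D x f := by
  simp [ham₁_apply, ham₂_apply, ham₃_apply, hx, hD 2 1, hD 3 1, hD 3 2]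
  ring

lemma ham₃_ham₁ (f : A) : ham₃ D x (ham₁ D x f) = ham₁ D x (ham₃ D x f) - ham₂ D x f := by
  simp [ham₁_apply, ham₂_apply, ham₃_apply, hx, hD 2 1, hD 3 1, hD 3 2]
  ring

lemma ham₁_ham₂ (f : A) : ham₁ D x (ham₂ D x f) = ham₂ D x (ham₁ D x f) - ham₃ D x f := by
  simp [ham₁_apply, ham₂_apply, ham₃_apply, hx, hD 2 1, hD 3 1, hD 3 2]
  ring

/-- `(E² + E) f = Ω f + Q² Δ f` for the Euler operator `E`, the Casimir operator `Ω` and the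
Laplace operator `Δ` of the quadratic form `Q²`. -/
lemma euler_euler_add_euler (f : A) {E : A → A}
    (hE : ∀ f, E f = x 1 * D 1 f + x 2 * D 2 f + x 3 * D 3 f) :
    E (E f) + E f =
      -ham₁ D x (ham₁ D x f) + ham₂ D x (ham₂ D x f) + ham₃ D x (ham₃ D x f)
      + Q x 1 * (-D 1 (D 1 f) + D 2 (D 2 f) + D 3 (D 3 f)) := by
  simp [hE, ham₁_apply, ham₂_apply, ham₃_apply, hx, hD 2 1, hD 3 1, hD 3 2, Q]
  ring

end Differential

/-! ### Whitehead's lemmas, given an inverse of the Casimir operator. -/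

section Whitehead

variable {A : Type*} [CommRing A] [Algebra ℝ A] {D : Fin 4 → Derivation ℝ A A} {x : Fin 4 → A}

lemma isFreeOnClass_of {π : Multivector A} {k : ℕ} {P : Multivector A}
    (hP : P ∈ cocycles D π k)
    (hspan : ∀ Z ∈ cocycles D π k, ∃ c : casimir D π, Z - c • P ∈ coboundaries D π k)
    (hfree : ∀ c : casimir D π, c • P ∈ coboundaries D π k → c = 0) :
    IsFreeOnClass D π k P := by
  let p : Cohomology D π k := Submodule.Quotient.mk ⟨P, hP⟩
  refine ⟨hP, Module.Basis.mk (v := fun _ : Unit => p) ?_ ?_, ?_⟩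
  · rw [Fintype.linearIndependent_iff]
    rintro c hc ⟨⟩
    rw [Fintype.sum_unique] at hc
    have hc' : (Submodule.Quotient.mk (c () • (⟨P, hP⟩ : cocycles D π k)) : Cohomology D π k) = 0 :=
      hc
    have h := (Submodule.Quotient.mk_eq_zero _).1 hc'
    exact hfree _ h
  · rintro z -
    obtain ⟨⟨Z, hZ⟩, rfl⟩ := Submodule.Quotient.mk_surjective _ z
    obtain ⟨c, hc⟩ := hspan Z hZ
    have : (Submodule.Quotient.mk ⟨Z, hZ⟩ : Cohomology D π k) = c • p :=
      (Submodule.Quotient.eq _).2 hc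
    rw [this]
    exact Submodule.smul_mem _ c (Submodule.subset_span ⟨(), rfl⟩)
  · simp [p]

lemma fn_eq_smul_one (f : A) : fn f = f • (1 : Multivector A) := by
  rw [← fn_mul, mul_one]

lemma casimir_smul (π : Multivector A) (c : casimir D π) (P : Multivector A) :
    c • P = (c : A) • P := rfl

lemma mem_casimir (hx : ∀ i j, D i (x j) = if i = j then 1 else 0) {f : A} :
    f ∈ casimir D (piGamma x) ↔ ham₁ D x f = 0 ∧ ham₂ D x f = 0 ∧ ham₃ D x f = 0 := by
  change schouten D (piGamma x) (fn f) = 0 ↔ _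
  rw [fn_eq_smul_one, schouten_smul_one hx]
  refine ⟨vec_eq_zero, ?_⟩
  rintro ⟨h₁, h₂, h₃⟩
  simp [h₁, h₂, h₃, vec]

/-- A projection `P` onto the Casimirs, together with an inverse `G` of the Casimir operator
`-ham₁² + ham₂² + ham₃²` on the kernel of `P`, both equivariant. -/
structure IsCasimirSplitting (D : Fin 4 → Derivation ℝ A A) (x : Fin 4 → A) (P G : A →ₗ[ℝ] A) :
    Prop where
  ham₁_proj (f : A) : ham₁ D x (P f) = 0
  ham₂_proj (f : A) : ham₂ D x (P f) = 0
  ham₃_proj (f : A) : ham₃ D x (P f) = 0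
  proj_ham₁ (f : A) : P (ham₁ D x f) = 0
  proj_ham₂ (f : A) : P (ham₂ D x f) = 0
  proj_ham₃ (f : A) : P (ham₃ D x f) = 0
  green_ham₁ (f : A) : G (ham₁ D x f) = ham₁ D x (G f)
  green_ham₂ (f : A) : G (ham₂ D x f) = ham₂ D x (G f)
  green_ham₃ (f : A) : G (ham₃ D x f) = ham₃ D x (G f)
  split (f : A) : f = P f + (-ham₁ D x (ham₁ D x (G f)) + ham₂ D x (ham₂ D x (G f))
    + ham₃ D x (ham₃ D x (G f)))

variable {P G : A →ₗ[ℝ] A} (hx : ∀ i j, D i (x j) = if i = j then 1 else 0)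
  (hD : ∀ i j f, D i (D j f) = D j (D i f)) (S : IsCasimirSplitting D x P G)
include hx S

lemma IsCasimirSplitting.proj_mem (f : A) : P f ∈ casimir D (piGamma x) :=
  (mem_casimir hx).2 ⟨S.ham₁_proj f, S.ham₂_proj f, S.ham₃_proj f⟩

/-- The Casimir operator commutes with `G` and kills `f`, so the second summand of `split` vanishes.
-/
lemma IsCasimirSplitting.proj_eq_self {f : A} (hf : f ∈ casimir D (piGamma x)) : P f = f := by
  obtain ⟨h₁, h₂, h₃⟩ := (mem_casimir hx).1 hf
  have h := S.split f
  rw [← S.green_ham₁, ← S.green_ham₁, ← S.green_ham₂, ← S.green_ham₂, ← S.green_ham₃,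
    ← S.green_ham₃, h₁, h₂, h₃] at h
  simpa using h.symm

lemma IsCasimirSplitting.exists_trivec (f : A) :
    ∃ G₁ G₂ G₃ : A, trivec f = schouten D (piGamma x) (bivec G₁ G₂ G₃) + trivec (P f) := by
  refine ⟨-ham₁ D x (G f), ham₂ D x (G f), ham₃ D x (G f), ?_⟩
  rw [schouten_bivec hx, map_neg, trivec, trivec, trivec, ← add_smul, add_comm, ← S.split f]

/-- `P` kills the images of the `ham` operators, hence the coefficient of any coboundary, but fixes
the Casimir `f`. -/
lemma IsCasimirSplitting.eq_zero_of_trivec {f G₁ G₂ G₃ : A} (hf : f ∈ casimir D (piGamma x))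
    (h : trivec f = schouten D (piGamma x) (bivec G₁ G₂ G₃)) : f = 0 := by
  rw [schouten_bivec hx, ← sub_eq_zero, trivec, trivec, ← sub_smul] at h
  have h' := trivec_eq_zero h
  rw [← S.proj_eq_self hx hf, sub_eq_zero.1 h', map_add, map_add, S.proj_ham₁, S.proj_ham₂,
    S.proj_ham₃, add_zero, add_zero]

include hD

lemma IsCasimirSplitting.exists_vec {F₁ F₂ F₃ : A}
    (h : schouten D (piGamma x) (vec F₁ F₂ F₃) = 0) :
    ∃ f : A, vec F₁ F₂ F₃ = schouten D (piGamma x) (f • 1) := by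
  rw [schouten_vec hx] at h
  obtain ⟨h₁, h₂, h₃⟩ := bivec_eq_zero h
  have p₁ := congrArg P h₁
  have p₂ := congrArg P h₂
  have p₃ := congrArg P h₃
  have g₁ := congrArg G h₁
  have g₂ := congrArg G h₂
  have g₃ := congrArg G h₃
  -- Projecting the cocycle equations leaves only the bracket terms, so every `P Fᵢ` is zero: the
  -- algebra is perfect.
  simp only [map_add, map_sub, S.proj_ham₁, S.proj_ham₂, S.proj_ham₃, map_zero, sub_zero,
    zero_sub, zero_add, neg_eq_zero] at p₁ p₂ p₃
  simp only [map_add, map_sub, S.green_ham₁, S.green_ham₂, S.green_ham₃, map_zero] at g₁ g₂ g₃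
  -- The standard contracting homotopy: contract with the dual basis for the Casimir form, of signs
  -- `-, +, +`, after applying `G`.
  refine ⟨-ham₁ D x (G F₁) + ham₂ D x (G F₂) + ham₃ D x (G F₃), ?_⟩
  rw [schouten_smul_one hx]
  have e₁ := S.split F₁
  have e₂ := S.split F₂
  have e₃ := S.split F₃
  rw [p₁] at e₁
  rw [p₂] at e₂
  rw [p₃] at e₃
  have k₂₁ := congrArg (ham₂ D x) g₁
  have k₃₁ := congrArg (ham₃ D x) g₁
  have k₁₂ := congrArg (ham₁ D x) g₂
  have k₃₂ := congrArg (ham₃ D x) g₂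
  have k₁₃ := congrArg (ham₁ D x) g₃
  have k₂₃ := congrArg (ham₂ D x) g₃
  simp only [map_add, map_sub, map_zero, ham₂_ham₃ hx hD, ham₃_ham₁ hx hD, ham₁_ham₂ hx hD]
    at k₂₁ k₃₁ k₁₂ k₃₂ k₁₃ k₂₃
  congr 1 <;> simp only [map_add, map_neg, ham₂_ham₃ hx hD, ham₃_ham₁ hx hD, ham₁_ham₂ hx hD]
  · linear_combination e₁ + k₃₂ - k₂₃
  · linear_combination e₂ - k₃₁ - k₁₃
  · linear_combination e₃ + k₂₁ + k₁₂

lemma IsCasimirSplitting.exists_bivec {G₁ G₂ G₃ : A}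
    (h : schouten D (piGamma x) (bivec G₁ G₂ G₃) = 0) :
    ∃ F₁ F₂ F₃ : A, bivec G₁ G₂ G₃ = schouten D (piGamma x) (vec F₁ F₂ F₃) := by
  rw [schouten_bivec hx] at h
  have g := congrArg G (trivec_eq_zero h)
  simp only [map_add, S.green_ham₁, S.green_ham₂, S.green_ham₃, map_zero] at g
  -- The terms with `G` are the contracting homotopy. The invariant parts `P Gᵢ` are made exact by
  -- the bracket terms of `schouten_vec`, whose signs `-, +, +` they copy.
  refine ⟨ham₃ D x (G G₂) - ham₂ D x (G G₃) - P G₁, -ham₃ D x (G G₁) - ham₁ D x (G G₃) + P G₂,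
    ham₂ D x (G G₁) + ham₁ D x (G G₂) + P G₃, ?_⟩
  rw [schouten_vec hx]
  have e₁ := S.split G₁
  have e₂ := S.split G₂
  have e₃ := S.split G₃
  have k₁ := congrArg (ham₁ D x) g
  have k₂ := congrArg (ham₂ D x) g
  have k₃ := congrArg (ham₃ D x) g
  simp only [map_add, map_zero, ham₂_ham₃ hx hD, ham₃_ham₁ hx hD, ham₁_ham₂ hx hD] at k₁ k₂ k₃
  congr 1 <;> simp only [map_add, map_sub, map_neg, S.ham₁_proj, S.ham₂_proj, S.ham₃_proj,
    ham₂_ham₃ hx hD, ham₃_ham₁ hx hD, ham₁_ham₂ hx hD]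
  · linear_combination e₁ - k₁
  · linear_combination e₂ + k₂
  · linear_combination e₃ + k₃

end Whitehead

/-! ### The cohomology assembled from its parts with and without `∂₀`. -/

section Cohomology

variable {A : Type*} [CommRing A] [Algebra ℝ A] {D : Fin 4 → Derivation ℝ A A} {x : Fin 4 → A}

lemma schouten_neg (π P : Multivector A) : schouten D π (-P) = -schouten D π P :=
  (dPoisson D π).map_neg P

lemma schouten_zero (π : Multivector A) : schouten D π 0 = 0 :=
  (dPoisson D π).map_zero

lemma mem_cocycles {π P : Multivector A} {k : ℕ} :
    P ∈ cocycles D π k ↔ P ∈ degree A k ∧ schouten D π P = 0 := Iff.rfl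

lemma mem_coboundaries_succ {π Z : Multivector A} {k : ℕ} :
    Z ∈ coboundaries D π (k + 1) ↔ ∃ P ∈ degree A k, schouten D π P = Z := Iff.rfl

variable (hx : ∀ i j, D i (x j) = if i = j then 1 else 0)
  (hD : ∀ i j f, D i (D j f) = D j (D i f))
include hx

lemma schouten_one : schouten D (piGamma x) 1 = 0 := by
  rw [← one_smul A (1 : Multivector A), schouten_smul_one hx]
  simp [vec, ham₁_apply, ham₂_apply, ham₃_apply]

/-- In degrees 0 and 1 of the normal complex, `d² = 0` is a consequence of the commutation
relations. -/
lemma schouten_smul_one_mem_cocycles (hD : ∀ i j f, D i (D j f) = D j (D i f)) (f : A) :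
    schouten D (piGamma x) (f • 1) ∈ cocycles D (piGamma x) 1 := by
  rw [mem_cocycles, schouten_smul_one hx]
  refine ⟨vec_mem_degree _ _ _, ?_⟩
  rw [schouten_vec hx]
  simp only [ham₂_ham₃ hx hD, ham₃_ham₁ hx hD, ham₁_ham₂ hx hD]
  simp [bivec]

lemma schouten_vec_mem_cocycles (hD : ∀ i j f, D i (D j f) = D j (D i f)) (F₁ F₂ F₃ : A) :
    schouten D (piGamma x) (vec F₁ F₂ F₃) ∈ cocycles D (piGamma x) 2 := by
  rw [mem_cocycles, schouten_vec hx]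
  refine ⟨bivec_mem_degree _ _ _, ?_⟩
  rw [schouten_bivec hx]
  simp only [map_add, map_sub, ham₂_ham₃ hx hD, ham₃_ham₁ hx hD, ham₁_ham₂ hx hD]
  ring_nf
  simp [trivec]

lemma schouten_bivec_mem_cocycles (G₁ G₂ G₃ : A) :
    schouten D (piGamma x) (bivec G₁ G₂ G₃) ∈ cocycles D (piGamma x) 3 := by
  rw [mem_cocycles, schouten_bivec hx]
  exact ⟨trivec_mem_degree _, schouten_trivec hx _⟩

lemma schouten_trivec_mem_cocycles (k : ℕ) (f : A) :
    schouten D (piGamma x) (trivec f) ∈ cocycles D (piGamma x) k := by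
  rw [schouten_trivec hx]
  exact zero_mem _

lemma schouten_vf_zero_mul_mem_cocycles {P : Multivector A} {k : ℕ}
    (hP : schouten D (piGamma x) P ∈ cocycles D (piGamma x) k) :
    schouten D (piGamma x) (vf A 0 * P) ∈ cocycles D (piGamma x) (k + 1) := by
  rw [mem_cocycles] at hP ⊢
  rw [schouten_vf_zero_mul hx, schouten_neg, schouten_vf_zero_mul hx, hP.2]
  exact ⟨neg_mem (vf_mul_mem_degree _ hP.1), by simp⟩

lemma isFreeOnClass_zero : IsFreeOnClass D (piGamma x) 0 1 := by
  refine isFreeOnClass_of ?_ ?_ ?_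
  · refine mem_cocycles.2 ⟨one_mem_degree, ?_⟩
    exact schouten_one hx
  · intro Z hZ
    obtain ⟨hZ, hd⟩ := mem_cocycles.1 hZ
    obtain ⟨f, rfl⟩ := exists_of_mem_degree_zero hZ
    refine ⟨⟨f, by rwa [← fn_eq_smul_one] at hd⟩, ?_⟩
    rw [casimir_smul, sub_self]
    exact zero_mem _
  · intro c hc
    exact Subtype.ext (smul_one_eq_zero ((Submodule.mem_bot _).1 hc))

include hD

lemma coboundaries_le_cocycles (k : ℕ) :
    coboundaries D (piGamma x) k ≤ cocycles D (piGamma x) k := by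
  match k with
  | 0 => exact bot_le
  | k + 1 =>
    intro Z hZ
    obtain ⟨P, hP, rfl⟩ := mem_coboundaries_succ.1 hZ
    match k with
    | 0 =>
      obtain ⟨f, rfl⟩ := exists_of_mem_degree_zero hP
      exact schouten_smul_one_mem_cocycles hx hD f
    | 1 =>
      obtain ⟨f, F₁, F₂, F₃, rfl⟩ := exists_of_mem_degree_one hP
      rw [schouten_add]
      exact add_mem (schouten_vf_zero_mul_mem_cocycles hx (schouten_smul_one_mem_cocycles hx hD f))
        (schouten_vec_mem_cocycles hx hD _ _ _)
    | 2 =>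
      obtain ⟨F₁, F₂, F₃, G₁, G₂, G₃, rfl⟩ := exists_of_mem_degree_two hP
      rw [schouten_add]
      exact add_mem (schouten_vf_zero_mul_mem_cocycles hx (schouten_vec_mem_cocycles hx hD _ _ _))
        (schouten_bivec_mem_cocycles hx _ _ _)
    | 3 =>
      obtain ⟨G₁, G₂, G₃, f, rfl⟩ := exists_of_mem_degree_three hP
      rw [schouten_add]
      exact add_mem (schouten_vf_zero_mul_mem_cocycles hx (schouten_bivec_mem_cocycles hx _ _ _))
        (schouten_trivec_mem_cocycles hx _ _)
    | 4 =>
      obtain ⟨f, rfl⟩ := exists_of_mem_degree_four hP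
      exact schouten_vf_zero_mul_mem_cocycles hx (schouten_trivec_mem_cocycles hx _ _)
    | k + 5 =>
      rw [degree_eq_bot, Submodule.mem_bot] at hP
      rw [hP, schouten_zero]
      exact zero_mem _

variable {P G : A →ₗ[ℝ] A} (S : IsCasimirSplitting D x P G)
include S

lemma isFreeOnClass_one : IsFreeOnClass D (piGamma x) 1 (vf A 0) := by
  refine isFreeOnClass_of ?_ ?_ ?_
  · refine mem_cocycles.2 ⟨vf_mem_degree 0, ?_⟩
    have h := schouten_vf_zero_mul hx 1
    rwa [mul_one, schouten_one hx, mul_zero, neg_zero] at h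
  · intro Z hZ
    obtain ⟨hZ, hd⟩ := mem_cocycles.1 hZ
    obtain ⟨f, F₁, F₂, F₃, rfl⟩ := exists_of_mem_degree_one hZ
    rw [schouten_add, schouten_vf_zero_mul hx, ← mul_neg] at hd
    obtain ⟨h₀, h₁⟩ := vf_zero_mul_add_eq_zero
      (by rw [schouten_smul_one hx, map_neg, contrL_zero_vec, neg_zero])
      (by rw [schouten_vec hx, contrL_zero_bivec]) hd
    rw [neg_eq_zero, ← fn_eq_smul_one] at h₀
    obtain ⟨g, hg⟩ := S.exists_vec hx hD h₁
    refine ⟨⟨f, h₀⟩, mem_coboundaries_succ.2 ⟨g • 1, smul_one_mem_degree g, ?_⟩⟩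
    rw [casimir_smul, mul_smul_comm, mul_one, hg]
    simp
  · intro c hc
    obtain ⟨P, hP, h⟩ := mem_coboundaries_succ.1 hc
    obtain ⟨g, rfl⟩ := exists_of_mem_degree_zero hP
    rw [schouten_smul_one hx, casimir_smul, eq_comm, ← sub_eq_zero, sub_eq_add_neg,
      ← mul_one (vf A 0), ← mul_smul_comm] at h
    refine Subtype.ext (smul_one_eq_zero (vf_zero_mul_add_eq_zero (contrL_zero_smul_one _) ?_ h).1)
    rw [map_neg, contrL_zero_vec, neg_zero]

/-- The two components of a cocycle lie in degrees 1 and 2 of the normal complex, where the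
Whitehead lemmas provide primitives; the one along `∂₀` changes sign as `d` passes `∂₀`. -/
lemma subsingleton_cohomology_two : Subsingleton (Cohomology D (piGamma x) 2) := by
  rw [Submodule.Quotient.subsingleton_iff, Submodule.submoduleOf_eq_top]
  intro Z hZ
  obtain ⟨hZ, hd⟩ := mem_cocycles.1 hZ
  obtain ⟨F₁, F₂, F₃, G₁, G₂, G₃, rfl⟩ := exists_of_mem_degree_two hZ
  rw [schouten_add, schouten_vf_zero_mul hx, ← mul_neg] at hd
  obtain ⟨h₀, h₁⟩ := vf_zero_mul_add_eq_zero
    (by rw [schouten_vec hx, map_neg, contrL_zero_bivec, neg_zero])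
    (by rw [schouten_bivec hx, contrL_zero_trivec]) hd
  obtain ⟨g, hg⟩ := S.exists_vec hx hD (neg_eq_zero.1 h₀)
  obtain ⟨f₁, f₂, f₃, hf⟩ := S.exists_bivec hx hD h₁
  refine mem_coboundaries_succ.2 ⟨-(vf A 0 * g • 1) + vec f₁ f₂ f₃,
    add_mem (neg_mem (vf_mul_mem_degree _ (smul_one_mem_degree g))) (vec_mem_degree _ _ _), ?_⟩
  rw [schouten_add, schouten_neg, schouten_vf_zero_mul hx, neg_neg, hg, hf]

lemma isFreeOnClass_three :
    IsFreeOnClass D (piGamma x) 3 (vf A 1 * vf A 2 * vf A 3) := by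
  have htri (f : A) : f • (vf A 1 * vf A 2 * vf A 3) = trivec f := by rw [trivec, mul_assoc]
  refine isFreeOnClass_of ?_ ?_ ?_
  · rw [← one_smul A (vf A 1 * vf A 2 * vf A 3), htri]
    exact mem_cocycles.2 ⟨trivec_mem_degree 1, schouten_trivec hx 1⟩
  · intro Z hZ
    obtain ⟨hZ, hd⟩ := mem_cocycles.1 hZ
    obtain ⟨G₁, G₂, G₃, f, rfl⟩ := exists_of_mem_degree_three hZ
    rw [schouten_add, schouten_vf_zero_mul hx, schouten_trivec hx, ← mul_neg] at hd
    obtain ⟨h₀, -⟩ := vf_zero_mul_add_eq_zero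
      (by rw [schouten_bivec hx, map_neg, contrL_zero_trivec, neg_zero]) (map_zero _) hd
    obtain ⟨F₁, F₂, F₃, hF⟩ := S.exists_bivec hx hD (neg_eq_zero.1 h₀)
    obtain ⟨g₁, g₂, g₃, hg⟩ := S.exists_trivec hx f
    refine ⟨⟨P f, S.proj_mem hx f⟩, mem_coboundaries_succ.2
      ⟨-(vf A 0 * vec F₁ F₂ F₃) + bivec g₁ g₂ g₃,
        add_mem (neg_mem (vf_mul_mem_degree _ (vec_mem_degree _ _ _))) (bivec_mem_degree _ _ _),
        ?_⟩⟩
    rw [schouten_add, schouten_neg, schouten_vf_zero_mul hx, neg_neg, casimir_smul, htri, hF, hg]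
    abel
  · intro c hc
    obtain ⟨R, hR, h⟩ := mem_coboundaries_succ.1 hc
    obtain ⟨F₁, F₂, F₃, G₁, G₂, G₃, rfl⟩ := exists_of_mem_degree_two hR
    rw [schouten_add, schouten_vf_zero_mul hx, casimir_smul, htri, ← sub_eq_zero, add_sub_assoc,
      ← mul_neg] at h
    have h₁ := (vf_zero_mul_add_eq_zero
      (by rw [schouten_vec hx, map_neg, contrL_zero_bivec, neg_zero])
      (by rw [schouten_bivec hx, map_sub, contrL_zero_trivec, contrL_zero_trivec, sub_zero]) h).2
    exact Subtype.ext (S.eq_zero_of_trivec hx c.2 (sub_eq_zero.1 h₁).symm)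

omit hD in
lemma isFreeOnClass_four :
    IsFreeOnClass D (piGamma x) 4 (vf A 0 * vf A 1 * vf A 2 * vf A 3) := by
  have htri (f : A) : f • (vf A 0 * vf A 1 * vf A 2 * vf A 3) = vf A 0 * trivec f := by
    rw [trivec, mul_smul_comm, mul_assoc, mul_assoc]
  have hd (f : A) : schouten D (piGamma x) (vf A 0 * trivec f) = 0 := by
    rw [schouten_vf_zero_mul hx, schouten_trivec hx, mul_zero, neg_zero]
  refine isFreeOnClass_of ?_ ?_ ?_
  · rw [← one_smul A (vf A 0 * vf A 1 * vf A 2 * vf A 3), htri]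
    exact mem_cocycles.2 ⟨vf_mul_mem_degree _ (trivec_mem_degree 1), hd 1⟩
  · intro Z hZ
    obtain ⟨f, rfl⟩ := exists_of_mem_degree_four (mem_cocycles.1 hZ).1
    obtain ⟨g₁, g₂, g₃, hg⟩ := S.exists_trivec hx f
    refine ⟨⟨P f, S.proj_mem hx f⟩, mem_coboundaries_succ.2
      ⟨-(vf A 0 * bivec g₁ g₂ g₃), neg_mem (vf_mul_mem_degree _ (bivec_mem_degree _ _ _)), ?_⟩⟩
    rw [schouten_neg, schouten_vf_zero_mul hx, neg_neg, casimir_smul, htri, hg]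
    noncomm_ring
  · intro c hc
    obtain ⟨R, hR, h⟩ := mem_coboundaries_succ.1 hc
    obtain ⟨G₁, G₂, G₃, f, rfl⟩ := exists_of_mem_degree_three hR
    rw [schouten_add, schouten_vf_zero_mul hx, casimir_smul, htri, ← sub_eq_zero,
      schouten_trivec hx, add_zero, ← mul_neg, ← mul_sub, ← add_zero (vf A 0 * _)] at h
    have h₁ := (vf_zero_mul_add_eq_zero
      (by rw [schouten_bivec hx, map_sub, map_neg, contrL_zero_trivec, contrL_zero_trivec, neg_zero,
        sub_zero]) (map_zero _) h).1
    rw [← schouten_neg, sub_eq_zero] at h₁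
    refine Subtype.ext (S.eq_zero_of_trivec (G₁ := -G₁) (G₂ := -G₂) (G₃ := -G₃) hx c.2 ?_)
    rw [← h₁]
    simp only [bivec]
    congr 1
    module

theorem hasFoldCohomology : HasFoldCohomology D x where
  poisson := schouten_piGamma_self hx
  isComplex := coboundaries_le_cocycles hx hD
  H0 := isFreeOnClass_zero hx
  H1 := isFreeOnClass_one hx hD S
  H2 := subsingleton_cohomology_two hx hD S
  H3 := isFreeOnClass_three hx hD S
  H4 := isFreeOnClass_four hx S

end Cohomology

/-! ### Construction of the splitting from the grading by degree in `x₁, x₂, x₃`. -/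

section Splitting

variable {A : Type*} [CommRing A] [Algebra ℝ A] {D : Fin 4 → Derivation ℝ A A} {x : Fin 4 → A}

/-- `W c` multiplies the component of degree `n` in `x₁, x₂, x₃` by `c n`. -/
structure IsWeightAction (D : Fin 4 → Derivation ℝ A A) (x : Fin 4 → A)
    (W : (ℕ → ℝ) → A →ₗ[ℝ] A) : Prop where
  comp (c e : ℕ → ℝ) (f : A) : W c (W e f) = W (fun n => c n * e n) f
  one (f : A) : W (fun _ => 1) f = f
  zero (f : A) : W (fun _ => 0) f = 0
  add (c e : ℕ → ℝ) (f : A) : W c f + W e f = W (fun n => c n + e n) f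
  coord_mul (j : Fin 4) (hj : j ≠ 0) (c : ℕ → ℝ) (f : A) :
    W c (x j * f) = x j * W (fun n => c (n + 1)) f
  deriv (j : Fin 4) (hj : j ≠ 0) (c : ℕ → ℝ) (f : A) :
    D j (W c f) = W (fun n => c (n + 1)) (D j f)
  euler (f : A) : W (fun n => n) f = x 1 * D 1 f + x 2 * D 2 f + x 3 * D 3 f

/-- The Laplace operator of the quadratic form `Q²`. -/
noncomputable def laplace (D : Fin 4 → Derivation ℝ A A) : A →ₗ[ℝ] A :=
  -((D 1 : A →ₗ[ℝ] A) ∘ₗ (D 1 : A →ₗ[ℝ] A)) + (D 2 : A →ₗ[ℝ] A) ∘ₗ (D 2 : A →ₗ[ℝ] A)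
    + (D 3 : A →ₗ[ℝ] A) ∘ₗ (D 3 : A →ₗ[ℝ] A)

lemma laplace_apply (f : A) : laplace D f = -D 1 (D 1 f) + D 2 (D 2 f) + D 3 (D 3 f) := rfl

/-- The Laplace operator, normalized so that `f - Q² · lower f` is congruent to the component of
degree `0` modulo the image of the Casimir operator. -/
noncomputable def lower (D : Fin 4 → Derivation ℝ A A) (W : (ℕ → ℝ) → A →ₗ[ℝ] A) : A →ₗ[ℝ] A :=
  W (fun n => (((n : ℝ) + 2) * (n + 3))⁻¹) ∘ₗ laplace D

variable {W : (ℕ → ℝ) → A →ₗ[ℝ] A} (hW : IsWeightAction D x W)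

section
include hW

lemma IsWeightAction.ham₁_comm (c : ℕ → ℝ) (f : A) : ham₁ D x (W c f) = W c (ham₁ D x f) := by
  simp [ham₁_apply, hW.deriv, hW.coord_mul]

lemma IsWeightAction.ham₂_comm (c : ℕ → ℝ) (f : A) : ham₂ D x (W c f) = W c (ham₂ D x f) := by
  simp [ham₂_apply, hW.deriv, hW.coord_mul]

lemma IsWeightAction.ham₃_comm (c : ℕ → ℝ) (f : A) : ham₃ D x (W c f) = W c (ham₃ D x f) := by
  simp [ham₃_apply, hW.deriv, hW.coord_mul]

lemma IsWeightAction.deriv_zero_component (j : Fin 4) (hj : j ≠ 0) (f : A) :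
    D j (W (Pi.single 0 1) f) = 0 := by
  rw [hW.deriv j hj, ← hW.zero (D j f)]
  -- The indicator sequence of `0`, shifted by one, is identically zero.
  congr 1

lemma IsWeightAction.ham₁_zero_component (f : A) : ham₁ D x (W (Pi.single 0 1) f) = 0 := by
  simp [ham₁_apply, hW.deriv_zero_component]

lemma IsWeightAction.ham₂_zero_component (f : A) : ham₂ D x (W (Pi.single 0 1) f) = 0 := by
  simp [ham₂_apply, hW.deriv_zero_component]

lemma IsWeightAction.ham₃_zero_component (f : A) : ham₃ D x (W (Pi.single 0 1) f) = 0 := by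
  simp [ham₃_apply, hW.deriv_zero_component]

end

variable (hx : ∀ i j, D i (x j) = if i = j then 1 else 0)
  (hD : ∀ i j f, D i (D j f) = D j (D i f))
include hx

/-- `ham₁` is a derivation that kills the Casimir `Q²`. -/
lemma ham₁_Q_mul (f : A) : ham₁ D x (Q x 1 * f) = Q x 1 * ham₁ D x f := by
  simp [ham₁_apply, Q, hx, pow_two]
  ring

lemma ham₂_Q_mul (f : A) : ham₂ D x (Q x 1 * f) = Q x 1 * ham₂ D x f := by
  simp [ham₂_apply, Q, hx, pow_two]
  ring

lemma ham₃_Q_mul (f : A) : ham₃ D x (Q x 1 * f) = Q x 1 * ham₃ D x f := by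
  simp [ham₃_apply, Q, hx, pow_two]
  ring

include hD

/-- The `ham` operators are infinitesimal isometries of the quadratic form `Q²`. -/
lemma ham₁_laplace (f : A) : ham₁ D x (laplace D f) = laplace D (ham₁ D x f) := by
  simp [ham₁_apply, laplace_apply, hx, hD 2 1, hD 3 1, hD 3 2]
  ring

lemma ham₂_laplace (f : A) : ham₂ D x (laplace D f) = laplace D (ham₂ D x f) := by
  simp [ham₂_apply, laplace_apply, hx, hD 2 1, hD 3 1, hD 3 2]
  ring

lemma ham₃_laplace (f : A) : ham₃ D x (laplace D f) = laplace D (ham₃ D x f) := by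
  simp [ham₃_apply, laplace_apply, hx, hD 2 1, hD 3 1, hD 3 2]
  ring

include hW

lemma IsWeightAction.ham₁_lower (f : A) : ham₁ D x (lower D W f) = lower D W (ham₁ D x f) := by
  simp [lower, hW.ham₁_comm, ham₁_laplace hx hD]

lemma IsWeightAction.ham₂_lower (f : A) : ham₂ D x (lower D W f) = lower D W (ham₂ D x f) := by
  simp [lower, hW.ham₂_comm, ham₂_laplace hx hD]

lemma IsWeightAction.ham₃_lower (f : A) : ham₃ D x (lower D W f) = lower D W (ham₃ D x f) := by
  simp [lower, hW.ham₃_comm, ham₃_laplace hx hD]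

/-- The operator `N` inverts `E² + E` off degree `0`, for the Euler operator `E`. -/
lemma IsWeightAction.eq_add_lower (f : A) {N : A →ₗ[ℝ] A}
    (hN : N = W fun n => ((n : ℝ) * (n + 1))⁻¹) :
    f = W (Pi.single 0 1) f + (-ham₁ D x (ham₁ D x (N f)) + ham₂ D x (ham₂ D x (N f))
      + ham₃ D x (ham₃ D x (N f))) + Q x 1 * lower D W f := by
  have h := euler_euler_add_euler hx hD (N f) (E := W fun n => n) hW.euler
  have h₁ : laplace D (N f) = lower D W f := by
    -- Moving the weights past two derivatives shifts `n` by two, which accounts for the factors in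
    -- `lower`.
    have hs : (fun n : ℕ => (((n + 1 + 1 : ℕ) : ℝ) * ((n + 1 + 1 : ℕ) + 1))⁻¹)
        = fun n : ℕ => (((n : ℝ) + 2) * (n + 3))⁻¹ := by
      ext n; push_cast; ring_nf
    rw [lower, LinearMap.comp_apply, ← hs, laplace_apply, laplace_apply, hN]
    simp only [hW.deriv 1 (by decide), hW.deriv 2 (by decide), hW.deriv 3 (by decide), map_add,
      map_neg]
  rw [← laplace_apply, h₁, hN, hW.comp, hW.comp, hW.comp, hW.add] at h
  rw [hN, add_assoc, ← h, hW.add]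
  conv_lhs => rw [← hW.one f]
  congr 2
  ext n
  -- At `n = 0` the inverse weight is `0⁻¹ = 0`, and the projection onto degree 0 supplies the
  -- missing component.
  rcases n with _ | n
  · simp
  · have : ((n + 1 : ℕ) : ℝ) ≠ 0 := by positivity
    have : ((n + 1 : ℕ) : ℝ) + 1 ≠ 0 := by positivity
    simp only [Pi.single_eq_of_ne (Nat.succ_ne_zero n)]
    field_simp
    ring

/-- Solving `B f = L f + Q² · B (lower f)` for `B` produces the splitting. -/
theorem IsWeightAction.exists_splitting
    (hsep : ∀ f : A, (∀ k, Q x 1 ^ k ∣ f) → f = 0)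
    (hrec : ∀ L : A →ₗ[ℝ] A, ∃ B : A →ₗ[ℝ] A, ∀ f, B f = L f + Q x 1 * B (lower D W f)) :
    ∃ P G : A →ₗ[ℝ] A, IsCasimirSplitting D x P G ∧
      ∀ f, P f = W (Pi.single 0 1) f + Q x 1 * P (lower D W f) := by
  obtain ⟨P, hP⟩ := hrec (W (Pi.single 0 1))
  obtain ⟨G, hG⟩ := hrec (W fun n => ((n : ℝ) * (n + 1))⁻¹)
  -- Iterating the homogeneous recursion makes `B f` divisible by every power of `Q²`. Below, the
  -- defect in each required identity is shown to satisfy it.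
  have huniq (B : A → A) (h : ∀ f, B f = Q x 1 * B (lower D W f)) (f : A) : B f = 0 := by
    refine hsep _ fun k => ?_
    induction k generalizing f with
    | zero => simp
    | succ k ih => rw [h, pow_succ']; exact mul_dvd_mul_left _ (ih _)
  refine ⟨P, G, ?_, hP⟩
  constructor
  · refine huniq (fun f => ham₁ D x (P f)) fun f => ?_
    rw [hP f, map_add, ham₁_Q_mul hx, hW.ham₁_zero_component, zero_add]
  · refine huniq (fun f => ham₂ D x (P f)) fun f => ?_
    rw [hP f, map_add, ham₂_Q_mul hx, hW.ham₂_zero_component, zero_add]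
  · refine huniq (fun f => ham₃ D x (P f)) fun f => ?_
    rw [hP f, map_add, ham₃_Q_mul hx, hW.ham₃_zero_component, zero_add]
  · refine huniq (fun f => P (ham₁ D x f)) fun f => ?_
    rw [hP, ← hW.ham₁_comm, hW.ham₁_zero_component, zero_add, hW.ham₁_lower hx hD]
  · refine huniq (fun f => P (ham₂ D x f)) fun f => ?_
    rw [hP, ← hW.ham₂_comm, hW.ham₂_zero_component, zero_add, hW.ham₂_lower hx hD]
  · refine huniq (fun f => P (ham₃ D x f)) fun f => ?_
    rw [hP, ← hW.ham₃_comm, hW.ham₃_zero_component, zero_add, hW.ham₃_lower hx hD]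
  · refine fun f => sub_eq_zero.1 (huniq (fun f => G (ham₁ D x f) - ham₁ D x (G f)) (fun f => ?_) f)
    rw [hG f, hG, map_add, ham₁_Q_mul hx, hW.ham₁_comm, hW.ham₁_lower hx hD]
    ring
  · refine fun f => sub_eq_zero.1 (huniq (fun f => G (ham₂ D x f) - ham₂ D x (G f)) (fun f => ?_) f)
    rw [hG f, hG, map_add, ham₂_Q_mul hx, hW.ham₂_comm, hW.ham₂_lower hx hD]
    ring
  · refine fun f => sub_eq_zero.1 (huniq (fun f => G (ham₃ D x f) - ham₃ D x (G f)) (fun f => ?_) f)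
    rw [hG f, hG, map_add, ham₃_Q_mul hx, hW.ham₃_comm, hW.ham₃_lower hx hD]
    ring
  · refine fun f => sub_eq_zero.1 (huniq (fun f => f - (P f + (-ham₁ D x (ham₁ D x (G f))
      + ham₂ D x (ham₂ D x (G f)) + ham₃ D x (ham₃ D x (G f))))) (fun f => ?_) f)
    rw [hG f, hP f]
    simp only [map_add, ham₁_Q_mul hx, ham₂_Q_mul hx, ham₃_Q_mul hx]
    linear_combination hW.eq_add_lower hx hD f rfl

end Splitting

/-! ### Formal power series: weights, separation and convergence. -/

section PowerSeries

open MvPowerSeries Finsupp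

lemma coeff_serD (i : Fin 4) (f : Ser) (m : Fin 4 →₀ ℕ) :
    coeff m (serD i f) = coeff (m + single i 1) f * (m i + 1) := coeff_pderiv f m

lemma serD_serX (i j : Fin 4) : serD i (serX j) = if i = j then 1 else 0 := by
  simp only [serD, serX, pderiv_X, Pi.single_apply, eq_comm]

lemma serD_comm (i j : Fin 4) (f : Ser) : serD i (serD j f) = serD j (serD i f) := by
  ext m
  simp only [coeff_serD, add_right_comm m (single i 1)]
  by_cases h : i = j
  · subst h; rfl
  · simp [h, Ne.symm h]
    ring

lemma coeff_X_mul_eq_ite {σ : Type*} (j : σ) (f : MvPowerSeries σ ℝ) (m : σ →₀ ℕ) :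
    coeff m (X j * f) = if m j = 0 then 0 else coeff (m - single j 1) f := by
  rw [X, coeff_monomial_mul, one_mul]
  by_cases h : m j = 0
  · rw [if_pos h, if_neg]
    intro hle
    simpa [h] using hle j
  · rw [if_neg h, if_pos]
    rw [single_le_iff]
    omega

lemma coeff_serX_mul (j : Fin 4) (f : Ser) (m : Fin 4 →₀ ℕ) :
    coeff m (serX j * f) = if m j = 0 then 0 else coeff (m - single j 1) f :=
  coeff_X_mul_eq_ite j f m

/-- The degree of a monomial in `x₁, x₂, x₃`. -/
def weight (m : Fin 4 →₀ ℕ) : ℕ := m 1 + m 2 + m 3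

lemma weight_add_single {j : Fin 4} (hj : j ≠ 0) (m : Fin 4 →₀ ℕ) :
    weight (m + single j 1) = weight m + 1 := by
  fin_cases j <;> simp [weight] at hj ⊢ <;> ring

/-- Multiplication of the component of degree `n` in `x₁, x₂, x₃` by `c n`. -/
noncomputable def serW (c : ℕ → ℝ) : Ser →ₗ[ℝ] Ser where
  toFun f m := c (weight m) * coeff m f
  map_add' f g := by ext m; exact mul_add _ _ _
  map_smul' r f := by ext m; exact mul_left_comm _ _ _

lemma coeff_serW (c : ℕ → ℝ) (f : Ser) (m : Fin 4 →₀ ℕ) :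
    coeff m (serW c f) = c (weight m) * coeff m f := rfl

lemma serX_mul_serD_coeff (j : Fin 4) (f : Ser) (m : Fin 4 →₀ ℕ) :
    coeff m (serX j * serD j f) = m j * coeff m f := by
  rw [coeff_serX_mul, coeff_serD]
  by_cases h : m j = 0
  · simp [h]
  · have hle : single j 1 ≤ m := by rw [single_le_iff]; omega
    rw [if_neg h, tsub_add_cancel_of_le hle, tsub_apply, single_eq_same,
      Nat.cast_sub (by omega)]
    push_cast
    ring

lemma serW_isWeightAction : IsWeightAction serD serX serW where
  comp c e f := by ext m; simp only [coeff_serW]; ring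
  one f := by ext m; simp [coeff_serW]
  zero f := by ext m; simp [coeff_serW]
  add c e f := by ext m; simp only [map_add, coeff_serW]; ring
  coord_mul j hj c f := by
    ext m
    simp only [coeff_serW, coeff_serX_mul]
    by_cases h : m j = 0
    · simp [h]
    · have hle : single j 1 ≤ m := by rw [single_le_iff]; omega
      rw [if_neg h, if_neg h, ← weight_add_single hj, tsub_add_cancel_of_le hle]
  deriv j hj c f := by
    ext m
    simp only [coeff_serW, coeff_serD, weight_add_single hj]
    ring
  euler f := by
    ext m
    simp only [map_add, serX_mul_serD_coeff, coeff_serW, weight]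
    push_cast
    ring

lemma constantCoeff_Q_serX (i : Fin 2) : constantCoeff (Q serX i) = 0 := by
  fin_cases i <;> simp [Q, serX]

/-- As `q` has order at least one, `q ^ k * g` has order at least `k`. -/
lemma coeff_pow_mul_of_lt {q : Ser} (hq : constantCoeff q = 0) (g : Ser) {k : ℕ}
    {m : Fin 4 →₀ ℕ} (h : m.degree < k) : coeff m (q ^ k * g) = 0 := by
  refine coeff_of_lt_order ?_
  have h₁ : 1 ≤ q.order := one_le_order_iff_constCoeff_eq_zero.2 hq
  calc (m.degree : ℕ∞) < k := by exact_mod_cast h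
    _ = k • (1 : ℕ∞) := by simp
    _ ≤ k • q.order := nsmul_le_nsmul_right h₁ k
    _ ≤ (q ^ k).order := le_order_pow k
    _ ≤ (q ^ k).order + g.order := le_self_add
    _ ≤ (q ^ k * g).order := le_order_mul

lemma eq_zero_of_forall_pow_dvd {q : Ser} (hq : constantCoeff q = 0) {f : Ser}
    (h : ∀ k, q ^ k ∣ f) : f = 0 := by
  ext m
  obtain ⟨g, rfl⟩ := h (m.degree + 1)
  rw [coeff_pow_mul_of_lt hq g (Nat.lt_succ_self _), map_zero]

/-- `B = ∑ qᵏ L Sᵏ`. Powers of `q` alone force coefficientwise stabilization, so `S` and `L` need no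
continuity. -/
lemma exists_recursion_ser {q : Ser} (hq : constantCoeff q = 0) (S L : Ser →ₗ[ℝ] Ser) :
    ∃ B : Ser →ₗ[ℝ] Ser, ∀ f, B f = L f + q * B (S f) := by
  let T (n : ℕ) : Ser →ₗ[ℝ] Ser :=
    ∑ k ∈ Finset.range n, LinearMap.mulLeft ℝ (q ^ k) ∘ₗ L ∘ₗ S ^ k
  have hT (n : ℕ) (f : Ser) : T n f = ∑ k ∈ Finset.range n, q ^ k * L ((S ^ k) f) := by
    simp [T]
  have hT_succ (n : ℕ) (f : Ser) : T (n + 1) f = L f + q * T n (S f) := by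
    rw [hT, hT, Finset.sum_range_succ', Finset.mul_sum, add_comm]
    simp [pow_succ', pow_succ S, mul_assoc]
  have hstable (m : Fin 4 →₀ ℕ) (n : ℕ) (hn : m.degree < n) (f : Ser) :
      coeff m (T n f) = coeff m (T (m.degree + 1) f) := by
    induction n, hn using Nat.le_induction with
    | base => rfl
    | succ n hn ih =>
      rw [hT, Finset.sum_range_succ, ← hT, map_add, ih, coeff_pow_mul_of_lt hq _ hn, add_zero]
  let B : Ser →ₗ[ℝ] Ser :=
    { toFun f m := coeff m (T (m.degree + 1) f)
      map_add' f g := by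
        ext m
        change coeff m (T _ (f + g)) = coeff m (T _ f) + coeff m (T _ g)
        rw [map_add, map_add]
      map_smul' r f := by
        ext m
        change coeff m (T _ (r • f)) = r * coeff m (T _ f)
        rw [map_smul, map_smul, smul_eq_mul] }
  have hB (f : Ser) (m : Fin 4 →₀ ℕ) : coeff m (B f) = coeff m (T (m.degree + 1) f) := rfl
  refine ⟨B, fun f => ?_⟩
  ext m
  -- One term beyond the stable range is taken, so that `hT_succ` leaves a partial sum that is still
  -- stable at every `p.2 ≤ m`.
  rw [hB, ← hstable m (m.degree + 2) (by omega), hT_succ, map_add, map_add, coeff_mul, coeff_mul]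
  congr 1
  refine Finset.sum_congr rfl fun p hp => ?_
  have hp : p.1 + p.2 = m := by simpa using hp
  rw [hB, hstable p.2 (m.degree + 1)]
  rw [← hp, map_add]
  omega

theorem exists_splitting_ser : ∃ P G : Ser →ₗ[ℝ] Ser, IsCasimirSplitting serD serX P G ∧
    ∀ f, P f = serW (Pi.single 0 1) f + Q serX 1 * P (lower serD serW f) :=
  serW_isWeightAction.exists_splitting serD_serX serD_comm
    (fun _ => eq_zero_of_forall_pow_dvd (constantCoeff_Q_serX 1))
    (exists_recursion_ser (constantCoeff_Q_serX 1) _)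

lemma hasSubst_Q_serX : HasSubst (Q serX) :=
  hasSubst_of_constantCoeff_zero constantCoeff_Q_serX

end PowerSeries

/-! ### Casimir power series are the power series in `Q¹, Q²`. -/

section SeriesInCasimirs

open MvPowerSeries Finsupp

/-- The power series `∑ a n x₀ ^ n` in two variables. -/
noncomputable def axisSeries (a : ℕ → ℝ) : MvPowerSeries (Fin 2) ℝ :=
  fun d => if d 1 = 0 then a (d 0) else 0

lemma coeff_axisSeries (a : ℕ → ℝ) (d : Fin 2 →₀ ℕ) :
    coeff d (axisSeries a) = if d 1 = 0 then a (d 0) else 0 := rfl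

/-- As `Q¹ = x₀`, the substitution only renames the variable, and the single exponent `(e 0, 0)` can
contribute. -/
lemma coeff_subst_axisSeries (a : ℕ → ℝ) (e : Fin 4 →₀ ℕ) :
    coeff e (subst (Q serX) (axisSeries a) : Ser) = if weight e = 0 then a (e 0) else 0 := by
  rw [coeff_subst hasSubst_Q_serX]
  have he : weight e = 0 ↔ e = single 0 (e 0) := by
    constructor
    · intro h
      ext i
      simp only [weight] at h
      fin_cases i <;> simp <;> omega
    · intro h
      rw [h]
      simp [weight]
  have hX (n : ℕ) : ((single (0 : Fin 2) n).prod fun s k => Q serX s ^ k) = X 0 ^ n := by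
    rw [prod_single_index (h := fun s k => Q serX s ^ k) (pow_zero _)]
    rfl
  rw [finsum_eq_single _ (single 0 (e 0))]
  · rw [hX, coeff_X_pow, coeff_axisSeries]
    simp [he]
  · intro d hd
    rw [coeff_axisSeries]
    split_ifs with h
    · have hds : d = single 0 (d 0) := by
        ext i
        fin_cases i <;> simp [h]
      rw [hds, hX, coeff_X_pow, if_neg, smul_zero]
      intro h'
      apply hd
      rw [hds, h']
      simp
    · rw [zero_smul]

lemma deriv_subst_axisSeries {j : Fin 4} (hj : j ≠ 0) (a : ℕ → ℝ) :
    serD j (subst (Q serX) (axisSeries a)) = 0 := by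
  ext m
  rw [coeff_serD, coeff_subst_axisSeries, weight_add_single hj]
  simp

/-- Division by the second variable. After substitution each such step extracts a factor `Q²`, which
drives the inductions below. -/
lemma exists_eq_axisSeries_add (h : MvPowerSeries (Fin 2) ℝ) :
    ∃ a h', h = axisSeries a + X 1 * h' := by
  let h' : MvPowerSeries (Fin 2) ℝ := fun d => coeff (d + single 1 1) h
  have hh' (d) : coeff d h' = coeff (d + single 1 1) h := rfl
  refine ⟨fun n => coeff (single 0 n) h, h', ?_⟩
  ext d
  rw [map_add, coeff_axisSeries, coeff_X_mul_eq_ite]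
  by_cases hd : d 1 = 0
  · rw [if_pos hd, if_pos hd, add_zero]
    congr 2
    ext i
    fin_cases i <;> simp [hd]
  · have hle : single 1 1 ≤ d := by rw [single_le_iff]; omega
    rw [if_neg hd, if_neg hd, zero_add, hh', tsub_add_cancel_of_le hle]

lemma subst_axisSeries_add (a : ℕ → ℝ) (h : MvPowerSeries (Fin 2) ℝ) :
    (subst (Q serX) (axisSeries a + X 1 * h) : Ser) =
      subst (Q serX) (axisSeries a) + Q serX 1 * subst (Q serX) h := by
  rw [subst_add hasSubst_Q_serX, subst_mul hasSubst_Q_serX, subst_X hasSubst_Q_serX]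

/-- Avoids differentiating an infinite substitution: `ham` kills the series in `x₀` and is linear
over `Q²`, so its value on the result is divisible by every power of `Q²`. -/
lemma subst_mem_casimir (h : MvPowerSeries (Fin 2) ℝ) :
    (subst (Q serX) h : Ser) ∈ casimir serD (piGamma serX) := by
  have key (T : Ser →ₗ[ℝ] Ser) (hT : ∀ f, T (Q serX 1 * f) = Q serX 1 * T f)
      (hT₀ : ∀ f, (∀ j ≠ 0, serD j f = 0) → T f = 0) : T (subst (Q serX) h) = 0 := by
    refine eq_zero_of_forall_pow_dvd (constantCoeff_Q_serX 1) fun k => ?_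
    induction k generalizing h with
    | zero => simp
    | succ k ih =>
      obtain ⟨a, h', rfl⟩ := exists_eq_axisSeries_add h
      rw [subst_axisSeries_add, map_add, hT₀ _ fun j hj => deriv_subst_axisSeries hj a, zero_add,
        hT, pow_succ']
      exact mul_dvd_mul_left _ (ih _)
  rw [mem_casimir serD_serX]
  refine ⟨key _ (ham₁_Q_mul serD_serX) ?_, key _ (ham₂_Q_mul serD_serX) ?_,
    key _ (ham₃_Q_mul serD_serX) ?_⟩
  · intro f hf; simp [ham₁_apply, hf]
  · intro f hf; simp [ham₂_apply, hf]
  · intro f hf; simp [ham₃_apply, hf]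

lemma coeff_Q_serX_mul_of_weight (f : Ser) {e : Fin 4 →₀ ℕ} (he : weight e = 0) :
    coeff e (Q serX 1 * f) = 0 := by
  have h : e 1 = 0 ∧ e 2 = 0 ∧ e 3 = 0 := by simp only [weight] at he; omega
  simp [Q, pow_two, add_mul, mul_assoc, coeff_serX_mul, h]

lemma Q_serX_one_ne_zero : Q serX 1 ≠ 0 := by
  intro h
  have h₂ : serD 2 (serD 2 (Q serX 1)) = 2 := by
    simp [Q, pow_two, serD_serX]
    norm_num
  rw [h, map_zero, map_zero] at h₂
  have h₃ := congrArg constantCoeff h₂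
  rw [map_zero, map_ofNat] at h₃
  norm_num at h₃

/-- On the axis `x₁ = x₂ = x₃ = 0` the series `Q²` vanishes, so the part free of the second variable
must be zero; then `Q²` cancels, and induction on the exponent of that variable concludes. -/
lemma injective_subst_Q :
    Function.Injective (subst (Q serX) : MvPowerSeries (Fin 2) ℝ → Ser) := by
  have key (n : ℕ) : ∀ h : MvPowerSeries (Fin 2) ℝ, (subst (Q serX) h : Ser) = 0 →
      ∀ d, d 1 = n → coeff d h = 0 := by
    induction n with
    | zero =>
      intro h h₀ d hd
      obtain ⟨a, h', rfl⟩ := exists_eq_axisSeries_add h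
      rw [subst_axisSeries_add] at h₀
      have h₁ := congrArg (coeff (single 0 (d 0))) h₀
      rw [map_add, coeff_subst_axisSeries, coeff_Q_serX_mul_of_weight _ (by simp [weight])] at h₁
      have h₂ : a (d 0) = 0 := by simpa [weight] using h₁
      rw [map_add, coeff_axisSeries, h₂, coeff_X_mul_eq_ite, if_pos hd, if_pos hd, add_zero]
    | succ n ih =>
      intro h h₀ d hd
      obtain ⟨a, h', rfl⟩ := exists_eq_axisSeries_add h
      rw [subst_axisSeries_add] at h₀
      have ha : (subst (Q serX) (axisSeries a) : Ser) = 0 := by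
        ext e
        rw [coeff_subst_axisSeries]
        split_ifs with he
        · have h₁ := congrArg (coeff e) h₀
          rw [map_add, coeff_subst_axisSeries, if_pos he, coeff_Q_serX_mul_of_weight _ he] at h₁
          simpa using h₁
        · simp
      rw [ha, zero_add] at h₀
      have h₁ := (mul_eq_zero.1 h₀).resolve_left Q_serX_one_ne_zero
      rw [map_add, coeff_axisSeries, if_neg (by omega), coeff_X_mul_eq_ite,
        if_neg (by omega), zero_add]
      exact ih h' h₁ _ (by simp [hd])
  rw [← coe_substAlgHom hasSubst_Q_serX, injective_iff_map_eq_zero]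
  intro h h₀
  rw [substAlgHom_apply] at h₀
  ext d
  exact key _ h h₀ d rfl

lemma casimir_ser : (casimir serD (piGamma serX) : Set Ser) =
    Set.range (subst (Q serX) : MvPowerSeries (Fin 2) ℝ → Ser) := by
  obtain ⟨P, G, hS, hP⟩ := exists_splitting_ser
  refine Set.Subset.antisymm (fun f hf => ?_) ?_
  -- `H f` is read off from `P f = ∑ (Q²)ᵏ (lowerᵏ f)₀`; it solves the recursion of `P` with the
  -- second variable in place of `Q²`, whence `hPH`.
  · let H (f : Ser) : MvPowerSeries (Fin 2) ℝ :=
      fun d => coeff (single 0 (d 0)) ((lower serD serW ^ d 1) f)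
    have hH (f : Ser) : H f =
        axisSeries (fun n => coeff (single 0 n) f) + X 1 * H (lower serD serW f) := by
      ext d
      change coeff (single 0 (d 0)) ((lower serD serW ^ d 1) f) = _
      rw [map_add, coeff_axisSeries, coeff_X_mul_eq_ite]
      by_cases hd : d 1 = 0
      · rw [if_pos hd, if_pos hd, add_zero, hd]
        rfl
      · obtain ⟨n, hn⟩ := Nat.exists_eq_succ_of_ne_zero hd
        rw [if_neg hd, if_neg hd, zero_add]
        change _ = coeff (single 0 ((d - single (1 : Fin 2) 1 : Fin 2 →₀ ℕ) 0))
          ((lower serD serW ^ ((d - single (1 : Fin 2) 1 : Fin 2 →₀ ℕ) 1)) (lower serD serW f))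
        simp [hn, pow_succ]
    have haxis (f : Ser) : serW (Pi.single 0 1) f =
        subst (Q serX) (axisSeries fun n => coeff (single 0 n) f) := by
      ext e
      rw [coeff_serW, coeff_subst_axisSeries]
      by_cases he : weight e = 0
      · rw [he, if_pos rfl, Pi.single_eq_same, one_mul]
        congr 2
        ext i
        simp only [weight] at he
        fin_cases i <;> simp <;> omega
      · simp [he]
    have hPH (f : Ser) : P f - subst (Q serX) (H f) = 0 := by
      refine eq_zero_of_forall_pow_dvd (constantCoeff_Q_serX 1) fun k => ?_
      induction k generalizing f with
      | zero => simp
      | succ k ih =>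
        rw [hP, hH, subst_axisSeries_add, haxis, add_sub_add_left_eq_sub, ← mul_sub, pow_succ']
        exact mul_dvd_mul_left _ (ih _)
    exact ⟨H f, by rw [← sub_eq_zero.1 (hPH f), hS.proj_eq_self serD_serX hf]⟩
  · rintro _ ⟨h, rfl⟩
    exact subst_mem_casimir h

end SeriesInCasimirs

/-! ### Polynomials, through their embedding in power series. -/

section Polynomials

open MvPolynomial

lemma polyD_polyX (i j : Fin 4) : polyD i (polyX j) = if i = j then 1 else 0 := by
  simp only [polyD, polyX, pderiv_X, Pi.single_apply, eq_comm]

lemma coe_polyD (i : Fin 4) (f : Poly) : ((polyD i f : Poly) : Ser) = serD i f :=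
  (MvPowerSeries.pderiv_coe f).symm

lemma coe_polyX (i : Fin 4) : ((polyX i : Poly) : Ser) = serX i := coe_X i

lemma polyD_comm (i j : Fin 4) (f : Poly) : polyD i (polyD j f) = polyD j (polyD i f) :=
  coe_injective _ _ (by simp only [coe_polyD, serD_comm i j])

/-- Multiplication of the component of degree `n` in `x₁, x₂, x₃` by `c n`. -/
noncomputable def polyW (c : ℕ → ℝ) : Poly →ₗ[ℝ] Poly :=
  (basisMonomials (Fin 4) ℝ).constr ℝ fun m => monomial m (c (weight m))

lemma polyW_monomial (c : ℕ → ℝ) (m : Fin 4 →₀ ℕ) (r : ℝ) :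
    polyW c (monomial m r) = monomial m (c (weight m) * r) := by
  have h : monomial m r = r • basisMonomials (Fin 4) ℝ m := by
    simp [smul_monomial]
  rw [h, map_smul, polyW, Module.Basis.constr_basis, smul_monomial, smul_eq_mul, mul_comm]

lemma coeff_polyW (c : ℕ → ℝ) (f : Poly) (m : Fin 4 →₀ ℕ) :
    coeff m (polyW c f) = c (weight m) * coeff m f := by
  classical
  induction f using MvPolynomial.induction_on' with
  | monomial n r =>
    rw [polyW_monomial, coeff_monomial, coeff_monomial]
    split_ifs with h
    · rw [h]
    · rw [mul_zero]
  | add p q hp hq => rw [map_add, coeff_add, coeff_add, hp, hq, mul_add]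

lemma coe_polyW (c : ℕ → ℝ) (f : Poly) : ((polyW c f : Poly) : Ser) = serW c f := by
  ext m
  rw [coeff_coe, coeff_polyW, coeff_serW, coeff_coe]

/-- Every identity is inherited from power series, since the embedding is injective and compatible
with all the operations. -/
lemma polyW_isWeightAction : IsWeightAction polyD polyX polyW where
  comp c e f := coe_injective _ _ (by simp only [coe_polyW, serW_isWeightAction.comp])
  one f := coe_injective _ _ (by simp only [coe_polyW, serW_isWeightAction.one])
  zero f := coe_injective _ _ (by simp only [coe_polyW, serW_isWeightAction.zero, coe_zero])
  add c e f := coe_injective _ _ (by simp only [coe_add, coe_polyW, serW_isWeightAction.add])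
  coord_mul j hj c f := coe_injective _ _ (by
    simp only [coe_mul, coe_polyW, coe_polyX, serW_isWeightAction.coord_mul j hj])
  deriv j hj c f := coe_injective _ _ (by
    simp only [coe_polyD, coe_polyW, serW_isWeightAction.deriv j hj])
  euler f := coe_injective _ _ (by
    simp only [coe_add, coe_mul, coe_polyW, coe_polyD, coe_polyX, serW_isWeightAction.euler])

lemma coe_Q_polyX (i : Fin 2) : ((Q polyX i : Poly) : Ser) = Q serX i := by
  have h (p : Poly) : ((-p : Poly) : Ser) = -(p : Ser) := (coeToMvPowerSeries.ringHom).map_neg p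
  fin_cases i <;> simp [Q, coe_polyX, h]

lemma eq_zero_of_forall_Q_pow_dvd {f : Poly} (h : ∀ k, Q polyX 1 ^ k ∣ f) : f = 0 := by
  rw [← coe_eq_zero_iff]
  refine eq_zero_of_forall_pow_dvd (constantCoeff_Q_serX 1) fun k => ?_
  obtain ⟨g, hg⟩ := h k
  exact ⟨g, by rw [hg, coe_mul, coe_pow, coe_Q_polyX]⟩

/-- A locally nilpotent operator `S` admits a solution `B` of `B f = L f + q * B (S f)`. -/
lemma exists_recursion_of_locally_nilpotent {A : Type*} [CommRing A] [Algebra ℝ A]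
    (q : A) (S L : A →ₗ[ℝ] A) (hS : ∀ f, ∃ n, (S ^ n) f = 0) :
    ∃ B : A →ₗ[ℝ] A, ∀ f, B f = L f + q * B (S f) := by
  let T (n : ℕ) : A →ₗ[ℝ] A :=
    ∑ k ∈ Finset.range n, LinearMap.mulLeft ℝ (q ^ k) ∘ₗ L ∘ₗ S ^ k
  have hT (n : ℕ) (f : A) : T n f = ∑ k ∈ Finset.range n, q ^ k * L ((S ^ k) f) := by
    simp [T]
  have hT_succ (n : ℕ) (f : A) : T (n + 1) f = L f + q * T n (S f) := by
    rw [hT, hT, Finset.sum_range_succ', Finset.mul_sum, add_comm]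
    simp [pow_succ', pow_succ S, mul_assoc]
  have hzero {f : A} {n k : ℕ} (hf : (S ^ n) f = 0) (hk : n ≤ k) : (S ^ k) f = 0 := by
    obtain ⟨m, rfl⟩ := Nat.exists_eq_add_of_le' hk
    rw [pow_add, Module.End.mul_apply, hf, map_zero]
  have hstable {f : A} {n k : ℕ} (hf : (S ^ n) f = 0) (hk : n ≤ k) : T k f = T n f := by
    rw [hT, hT]
    refine (Finset.sum_subset (Finset.range_mono hk) fun i _ hi => ?_).symm
    rw [hzero hf (by simpa using hi), map_zero, mul_zero]
  choose N hN using hS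
  let B : A →ₗ[ℝ] A :=
    { toFun f := T (N f) f
      map_add' f g := by
        -- The chosen `N` depends arbitrarily on its argument; partial sums are compared at a common
        -- bound, where `T M` is linear.
        let M := max (N (f + g)) (max (N f) (N g))
        rw [← hstable (hN (f + g)) (k := M) (by simp [M]), ← hstable (hN f) (k := M) (by simp [M]),
          ← hstable (hN g) (k := M) (by simp [M]), map_add]
      map_smul' r f := by
        let M := max (N (r • f)) (N f)
        rw [← hstable (hN (r • f)) (k := M) (by simp [M]),
          ← hstable (hN f) (k := M) (by simp [M]), map_smul, RingHom.id_apply] }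
  refine ⟨B, fun f => ?_⟩
  let M := max (N f) (N (S f))
  change T (N f) f = L f + q * T (N (S f)) (S f)
  rw [← hstable (hN f) (k := M + 1) (by simp [M]; omega),
    ← hstable (hN (S f)) (k := M) (by simp [M]), hT_succ]

/-- `lower` decreases the degree of polynomials. -/
lemma exists_lower_pow_eq_zero (f : Poly) : ∃ n, (lower polyD polyW ^ n) f = 0 := by
  have hderiv (i : Fin 4) (n : ℕ) (f : Poly)
      (hf : ∀ m : Fin 4 →₀ ℕ, n + 1 ≤ m.degree → coeff m f = 0)
      (m : Fin 4 →₀ ℕ) (hm : n ≤ m.degree) : coeff m (polyD i f) = 0 := by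
    rw [← coeff_coe, coe_polyD, coeff_serD, coeff_coe, hf, zero_mul]
    simpa using hm
  have key (n : ℕ) : ∀ f : Poly, (∀ m : Fin 4 →₀ ℕ, n ≤ m.degree → coeff m f = 0) →
      (lower polyD polyW ^ n) f = 0 := by
    induction n with
    | zero => intro f hf; ext m; simpa using hf m (Nat.zero_le _)
    | succ n ih =>
      intro f hf
      rw [pow_succ, Module.End.mul_apply]
      refine ih _ fun m hm => ?_
      -- Of the two degrees lost to the derivatives, the induction uses only one.
      have h (i : Fin 4) : coeff m (polyD i (polyD i f)) = 0 :=
        hderiv i n _ (fun m hm => hderiv i n f hf m (by omega)) m hm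
      rw [lower, LinearMap.comp_apply, coeff_polyW, laplace_apply]
      simp [h]
  refine ⟨f.totalDegree + 1, key _ f fun m hm => coeff_eq_zero_of_totalDegree_lt ?_⟩
  rw [Finsupp.degree_apply] at hm
  exact hm

theorem exists_splitting_poly : ∃ P G : Poly →ₗ[ℝ] Poly, IsCasimirSplitting polyD polyX P G ∧
    ∀ f, P f = polyW (Pi.single 0 1) f + Q polyX 1 * P (lower polyD polyW f) :=
  polyW_isWeightAction.exists_splitting polyD_polyX polyD_comm
    (fun _ => eq_zero_of_forall_Q_pow_dvd)
    fun L => exists_recursion_of_locally_nilpotent _ _ L exists_lower_pow_eq_zero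

/-- Evaluation at `Q¹, Q²` is the restriction to polynomials of the injective substitution of power
series. -/
lemma algebraicIndependent_Q_polyX : AlgebraicIndependent ℝ (Q polyX) := by
  rw [algebraicIndependent_iff_injective_aeval]
  intro p q h
  refine coe_injective _ _ (injective_subst_Q ?_)
  have key (p : MvPolynomial (Fin 2) ℝ) :
      MvPowerSeries.subst (Q serX) (p : MvPowerSeries (Fin 2) ℝ) = ((aeval (Q polyX) p : Poly) : Ser) := by
    rw [MvPowerSeries.subst_coe]
    induction p using MvPolynomial.induction_on with
    | C r =>
      rw [algHom_C, algHom_C]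
      exact (coe_C r).symm
    | add p q hp hq => rw [map_add, map_add, hp, hq, coe_add]
    | mul_X p i hp => rw [map_mul, map_mul, hp, aeval_X, aeval_X, coe_mul, coe_Q_polyX]
  rw [key, key, h]

lemma polyW_single_mem_adjoin (f : Poly) :
    polyW (Pi.single 0 1) f ∈ Algebra.adjoin ℝ (Set.range (Q polyX)) := by
  induction f using MvPolynomial.induction_on' with
  | monomial m r =>
    rw [polyW_monomial]
    by_cases h : weight m = 0
    · have hm : m = Finsupp.single 0 (m 0) := by
        ext i
        simp only [weight] at h
        fin_cases i <;> simp <;> omega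
      rw [h, Pi.single_eq_same, one_mul, hm, ← C_mul_X_pow_eq_monomial]
      have hX : (X 0 : Poly) ∈ Algebra.adjoin ℝ (Set.range (Q polyX)) :=
        Algebra.subset_adjoin ⟨0, rfl⟩
      exact mul_mem (Subalgebra.algebraMap_mem _ r) (pow_mem hX _)
    · rw [Pi.single_eq_of_ne h, zero_mul, monomial_zero]
      exact zero_mem _
  | add p q hp hq => rw [map_add]; exact add_mem hp hq

lemma casimir_poly :
    casimir polyD (piGamma polyX) = Algebra.adjoin ℝ (Set.range (Q polyX)) := by
  obtain ⟨P, G, hS, hP⟩ := exists_splitting_poly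
  refine le_antisymm (fun f hf => ?_) (Algebra.adjoin_le ?_)
  · rw [← hS.proj_eq_self polyD_polyX hf]
    -- The remaining claim holds for `P f` with `f` arbitrary, which the induction requires since it
    -- passes to `lower f`.
    clear hf
    obtain ⟨n, hn⟩ := exists_lower_pow_eq_zero f
    induction n generalizing f with
    | zero =>
      rw [show f = 0 from hn, map_zero]
      exact zero_mem _
    | succ n ih =>
      rw [hP]
      rw [pow_succ, Module.End.mul_apply] at hn
      exact add_mem (polyW_single_mem_adjoin f)
        (mul_mem (Algebra.subset_adjoin ⟨1, rfl⟩) (ih _ hn))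
  · rintro _ ⟨i, rfl⟩
    refine (mem_casimir polyD_polyX).2 ?_
    fin_cases i <;> simp [Q, ham₁_apply, ham₂_apply, ham₃_apply, polyD_polyX, pow_two]
    refine ⟨?_, ?_, ?_⟩ <;> ring

end Polynomials

end FoldCircle

open FoldCircle in
theorem mainTheorem6 :
    -- polynomial coefficients
    (AlgebraicIndependent ℝ (Q polyX) ∧
      casimir polyD (piGamma polyX) = Algebra.adjoin ℝ (Set.range (Q polyX)) ∧
      HasFoldCohomology polyD polyX) ∧
    -- formal power series coefficients
    (MvPowerSeries.HasSubst (Q serX) ∧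
      Function.Injective (MvPowerSeries.subst (Q serX) : MvPowerSeries (Fin 2) ℝ → Ser) ∧
      (casimir serD (piGamma serX) : Set Ser) =
        Set.range (MvPowerSeries.subst (Q serX) : MvPowerSeries (Fin 2) ℝ → Ser) ∧
      HasFoldCohomology serD serX) := by
  obtain ⟨P, G, hS, -⟩ := exists_splitting_poly
  obtain ⟨P', G', hS', -⟩ := exists_splitting_ser
  exact ⟨⟨algebraicIndependent_Q_polyX, casimir_poly, hasFoldCohomology polyD_polyX polyD_comm hS⟩,
    hasSubst_Q_serX, injective_subst_Q, casimir_ser, hasFoldCohomology serD_serX serD_comm hS'⟩
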